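/- Let $(\mathcal M,\tau)$ be a tracial $W^*$-probability space, i.e. $\mathcal M$ is a von Neumann algebra acting on a complex Hilbert space $\mathcal H$ and $\tau$ is a faithful normal tracial state on $\mathcal M$. For a selfadjoint $X\in\mathcal M$ let $E_X$ denote its spectral projections. For projections $P,Q$ let $P\lor Q$ be the projection onto the closure of $P\mathcal H+Q\mathcal H$, and for selfadjoint $X,Y\in\mathcal M$ let $X\lor Y\in\mathcal M$ be their maximum in the spectral order, i.e. the selfadjoint element with $E_{X\lor Y}((x,\infty))=E_X((x,\infty))\lor E_Y((x,\infty))$ for all $x\in\mathbb R$. Let $U_1,U_2,\dots\in\mathcal M$ be selfadjoint and freely independent, each with the uniform distribution $U(0,1)$, i.e. $\tau(E_{U_i}(B))=|B\cap(0,1)|$ (Lebesgue measure) for all Borel sets $B$, and put $\tilde U_n:=U_1\lor\cdots\lor U_n$ for $n\ge1$. Define $\Lambda^\lor$ on $[0,1]$ by $\Lambda^\lor(0)=0$ and $\Lambda^\lor(y)=\max\{0,1+\log y\}$ for $0<y\le1$. For functions on $\mathbb R$ write $G_n\xrightarrow{w}G$ if $G_n(x)\to G(x)$ at every point $x$ of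 continuity of $G$. Then for every distribution function $F$ on $\mathbb R$, $$\tau\bigl(E_{\tilde U_n}([0,F^{1/n}])\bigr)\xrightarrow{w}\Lambda^\lor(F),\qquad n\to\infty,$$ where the left-hand side is the function $x\mapsto\tau(E_{\tilde U_n}([0,F(x)^{1/n}]))$. In particular, as $n\to\infty$ and for every $\alpha>0$, $$\tau\bigl(E_{\tilde U_n}([0,C_{\mathrm I}^{1/n}])\bigr)\xrightarrow{w}F_{\mathrm I},\qquad \tau\bigl(E_{\tilde U_n}([0,C_{\mathrm{II},\alpha}^{1/n}])\bigr)\xrightarrow{w}F_{\mathrm{II},\alpha},\qquad \tau\bigl(E_{\tilde U_n}([0,C_{\mathrm{III},\alpha}^{1/n}])\bigr)\xrightarrow{w}F_{\mathrm{III},\alpha},$$ with the distribution functions - $C_{\mathrm I}(x)=\exp(-e^{-x})$ (Gumbel) and $F_{\mathrm I}(x)=\max\{0,1-e^{-x}\}$ (exponential); - $C_{\mathrm{II},\alpha}(x)=\exp(-x^{-\alpha})$ for $x>0$ and $0$ for $x\le0$ (Fréchet), and $F_{\mathrm{II},\alpha}(x)=\max\{0,1-x^{-\alpha}\}$ for $x>0$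 and $0$ for $x\le 0$ (Pareto); - $C_{\mathrm{III},\alpha}(x)=\exp(-(-x)^\alpha)$ for $x\le0$ and $1$ for $x>0$ (Weibull), and $F_{\mathrm{III},\alpha}(x)=1-|x|^\alpha$ for $-1\le x\le0$, $0$ for $x<-1$ and $1$ for $x>0$ (Beta law). -/

import Mathlib

open MeasureTheory Filter Topology
open scoped ComplexOrder

universe u

section
variable {H : Type u} [NormedAddCommGroup H] [InnerProductSpace ℂ H] [CompleteSpace H]

/-- For a closed set `K ⊆ ℝ` and a bounded selfadjoint operator `X`, the range of the spectral
projection `E_X(K)`: the vectors killed by `f(X)` (continuous functional calculus) for every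
continuous `f : ℝ → ℝ` that vanishes on `K`. -/
def closedSpectralSubspace (X : H →L[ℂ] H) (K : Set ℝ) : Submodule ℂ H where
  carrier := {v | ∀ f : ℝ → ℝ, Continuous f → (∀ t ∈ K, f t = 0) → cfc f X v = 0}
  add_mem' := fun ha hb f hf h0 => by rw [map_add, ha f hf h0, hb f hf h0, add_zero]
  zero_mem' := fun f _ _ => map_zero _
  smul_mem' := fun c v hv f hf h0 => by rw [map_smul, hv f hf h0, smul_zero]

/-- The range of the spectral projection `E_X(B)` of a Borel set `B ⊆ ℝ`. As the spectral measure
is (strongly) inner regular, `E_X(B)` is the supremum of the projections `E_X(K)` over the closed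
sets `K ⊆ B`, so its range is the closed linear span of the ranges of these. -/
noncomputable def spectralSubspace (X : H →L[ℂ] H) (B : Set ℝ) : Submodule ℂ H :=
  (⨆ K : {K : Set ℝ // IsClosed K ∧ K ⊆ B}, closedSpectralSubspace X K.1).topologicalClosure

instance (X : H →L[ℂ] H) (B : Set ℝ) : (spectralSubspace X B).HasOrthogonalProjection :=
  inferInstanceAs (Submodule.topologicalClosure _).HasOrthogonalProjection

/-- The spectral projection `E_X(B) = 1_B(X)` of a bounded selfadjoint operator `X`. -/
noncomputable def spectralProjection (X : H →L[ℂ] H) (B : Set ℝ) : H →L[ℂ] H :=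
  (spectralSubspace X B).starProjection

theorem isClosed_spectralSubspace (X : H →L[ℂ] H) (B : Set ℝ) :
    IsClosed (spectralSubspace X B : Set H) := Submodule.isClosed_topologicalClosure _

theorem closedSpectralSubspace_le (X : H →L[ℂ] H) {K B : Set ℝ} (hK : IsClosed K) (h : K ⊆ B) :
    closedSpectralSubspace X K ≤ spectralSubspace X B :=
  (le_iSup (fun K : {K : Set ℝ // IsClosed K ∧ K ⊆ B} => closedSpectralSubspace X K.1)
    ⟨K, hK, h⟩).trans (Submodule.le_topologicalClosure _)

theorem spectralSubspace_le (X : H →L[ℂ] H) {B : Set ℝ} {S : Submodule ℂ H}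
    (hS : IsClosed (S : Set H))
    (h : ∀ K : Set ℝ, IsClosed K → K ⊆ B → closedSpectralSubspace X K ≤ S) :
    spectralSubspace X B ≤ S :=
  Submodule.topologicalClosure_minimal _ (iSup_le fun K => h K.1 K.2.1 K.2.2) hS

theorem spectralSubspace_mono (X : H →L[ℂ] H) {B C : Set ℝ} (h : B ⊆ C) :
    spectralSubspace X B ≤ spectralSubspace X C :=
  spectralSubspace_le X (isClosed_spectralSubspace X C) fun _ hK hKB =>
    closedSpectralSubspace_le X hK (hKB.trans h)

theorem range_spectralProjection (X : H →L[ℂ] H) (B : Set ℝ) :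
    (spectralProjection X B).range = spectralSubspace X B :=
  Submodule.range_starProjection _

theorem isStarProjection_spectralProjection (X : H →L[ℂ] H) (B : Set ℝ) :
    IsStarProjection (spectralProjection X B) := isStarProjection_starProjection

theorem spectralSubspace_Ioi_le (X : H →L[ℂ] H) (x : ℝ) {S : Submodule ℂ H}
    (hS : IsClosed (S : Set H)) (h : ∀ s > x, spectralSubspace X (Set.Ioi s) ≤ S) :
    spectralSubspace X (Set.Ioi x) ≤ S := by
  refine spectralSubspace_le X hS fun K hK hKx => ?_
  obtain ⟨s, hs, hKs⟩ : ∃ s > x, K ⊆ Set.Ioi s := by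
    rcases K.eq_empty_or_nonempty with rfl | hne
    · exact ⟨x + 1, by linarith, Set.empty_subset _⟩
    · have hb : BddBelow K := ⟨x, fun t ht => (hKx ht).le⟩
      have h1 : sInf K ∈ K := hK.csInf_mem hne hb
      have h2 : x < sInf K := hKx h1
      exact ⟨(x + sInf K) / 2, by linarith, fun t ht => by
        have := csInf_le hb ht
        simp only [Set.mem_Ioi]; linarith⟩
  exact (closedSpectralSubspace_le X hK hKs).trans (h s hs)

theorem spectralSubspace_Ioi_le_orthogonal (X : H →L[ℂ] H) (hX : IsSelfAdjoint X) (x : ℝ) :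
    spectralSubspace X (Set.Ioi x) ≤ (cfc (fun t : ℝ => max (t - x) 0) X).kerᗮ := by
  set g : ℝ → ℝ → ℝ := fun y t => max (t - y) 0 with hg
  have hgc : ∀ y, Continuous (g y) := fun y => by fun_prop
  have hsa : ∀ f : ℝ → ℝ, ((cfc f X).adjoint) = cfc f X := fun f => by
    have : IsSelfAdjoint (cfc f X) := cfc_predicate f X
    exact this
  refine spectralSubspace_le X (Submodule.isClosed_orthogonal _) fun K hK hKx v hv => ?_
  rw [Submodule.mem_orthogonal]
  intro w hw
  obtain ⟨d, hd, hKd⟩ : ∃ d > 0, ∀ t ∈ K, x + d ≤ t := by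
    rcases K.eq_empty_or_nonempty with rfl | hne
    · exact ⟨1, one_pos, by simp⟩
    · have hb : BddBelow K := ⟨x, fun t ht => (hKx ht).le⟩
      have h2 : x < sInf K := hKx (hK.csInf_mem hne hb)
      exact ⟨sInf K - x, by linarith, fun t ht => by have := csInf_le hb ht; linarith⟩
  set h : ℝ → ℝ := fun t => (max (t - x) d)⁻¹ with hh
  have hhc : Continuous h := by
    refine Continuous.inv₀ (by fun_prop) fun t => (lt_max_of_lt_right hd).ne'
  have e1 : cfc (fun t => 1 - g x t * h t) X v = 0 := by
    refine hv _ (by fun_prop) fun t ht => ?_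
    have := hKd t ht
    simp only [hg, hh]
    rw [max_eq_left (by linarith), max_eq_left (by linarith), mul_inv_cancel₀ (by linarith),
      sub_self]
  rw [cfc_sub (fun _ => (1 : ℝ)) (fun t => g x t * h t) X, cfc_const_one ℝ X,
    cfc_mul (g x) h X (hgc x).continuousOn hhc.continuousOn] at e1
  have e2 : v = cfc (g x) X (cfc h X v) := by
    have : v - cfc (g x) X (cfc h X v) = 0 := e1
    exact sub_eq_zero.1 this
  have hw' : cfc (g x) X w = 0 := hw
  rw [e2, ← ContinuousLinearMap.adjoint_inner_left, hsa, hw', inner_zero_left]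

theorem orthogonal_le_spectralSubspace_Ioi (X : H →L[ℂ] H) (x : ℝ) :
    (cfc (fun t : ℝ => max (t - x) 0) X).kerᗮ ≤ spectralSubspace X (Set.Ioi x) := by
  set g : ℝ → ℝ → ℝ := fun y t => max (t - y) 0 with hg
  have hgc : ∀ y, Continuous (g y) := fun y => by fun_prop
  have hsa : ∀ f : ℝ → ℝ, ((cfc f X).adjoint) = cfc f X := fun f => by
    have : IsSelfAdjoint (cfc f X) := cfc_predicate f X
    exact this
  have hr : (cfc (g x) X).kerᗮ = (cfc (g x) X).range.topologicalClosure := by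
    conv_lhs => rw [← hsa (g x)]
    rw [← ContinuousLinearMap.orthogonal_range, Submodule.orthogonal_orthogonal_eq_closure]
  rw [hr]
  refine Submodule.topologicalClosure_minimal _ ?_ (isClosed_spectralSubspace X _)
  rintro _ ⟨u, rfl⟩
  have key : ∀ d : ℝ, 0 < d → cfc (g (x + d)) X u ∈ spectralSubspace X (Set.Ioi x) := by
    intro d hd
    have hsub : Set.Ici (x + d) ⊆ Set.Ioi x := Set.Ici_subset_Ioi.2 (by linarith)
    have hle := closedSpectralSubspace_le X isClosed_Ici hsub
    refine SetLike.le_def.1 hle fun f hf hf0 => ?_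
    have : cfc f X * cfc (g (x + d)) X = 0 := by
      rw [← cfc_mul f _ X hf.continuousOn (hgc _).continuousOn]
      convert cfc_zero ℝ X using 2
      funext t
      by_cases ht : x + d ≤ t
      · simp [hf0 t ht]
      · simp only [hg]; rw [max_eq_right (by linarith)]; simp
    exact congr($this u)
  have lim : Tendsto (fun d : ℝ => cfc (g (x + d)) X u) (𝓝[>] 0) (𝓝 (cfc (g x) X u)) := by
    have hb : Tendsto (fun d : ℝ => d * ‖u‖) (𝓝[>] 0) (𝓝 0) := by
      have h0 : Tendsto (fun d : ℝ => d) (𝓝[>] 0) (𝓝 0) := nhdsWithin_le_nhds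
      simpa using h0.mul_const ‖u‖
    refine tendsto_iff_norm_sub_tendsto_zero.2
      (squeeze_zero' (Eventually.of_forall fun _ => norm_nonneg _) ?_ hb)
    filter_upwards [self_mem_nhdsWithin] with d hd
    have hd : 0 < d := hd
    rw [← sub_apply, ← cfc_sub (g (x + d)) (g x) X (hgc _).continuousOn (hgc _).continuousOn]
    refine (ContinuousLinearMap.le_opNorm _ _).trans ?_
    gcongr
    refine norm_cfc_le hd.le fun t _ => ?_
    simp only [hg, Real.norm_eq_abs]
    refine (abs_max_sub_max_le_abs _ _ _).trans ?_
    rw [show t - (x + d) - (t - x) = -d by ring, abs_neg, abs_of_pos hd]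
  exact (isClosed_spectralSubspace X (Set.Ioi x)).mem_of_tendsto lim
    (by filter_upwards [self_mem_nhdsWithin] with d hd using key d hd)

theorem spectralSubspace_Ioi (X : H →L[ℂ] H) (hX : IsSelfAdjoint X) (x : ℝ) :
    spectralSubspace X (Set.Ioi x) = (cfc (fun t : ℝ => max (t - x) 0) X).kerᗮ :=
  le_antisymm (spectralSubspace_Ioi_le_orthogonal X hX x)
    (orthogonal_le_spectralSubspace_Ioi X x)

theorem abs_le_of_mem_spectrum (X : H →L[ℂ] H) {t : ℝ} (ht : t ∈ spectrum ℝ X) : |t| ≤ ‖X‖ := by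
  rcases subsingleton_or_nontrivial H with h | h
  · exact absurd ht (by rw [spectrum.of_subsingleton]; simp)
  · exact spectrum.norm_le_norm_of_mem ht

theorem spectralSubspace_Ioi_eq_top (X : H →L[ℂ] H) {x : ℝ} (hx : x < -‖X‖) :
    spectralSubspace X (Set.Ioi x) = ⊤ := by
  rw [eq_top_iff]
  refine le_trans ?_ (closedSpectralSubspace_le X (isClosed_Ici (a := -‖X‖))
    (fun t ht => lt_of_lt_of_le hx ht))
  intro v _ f _ hf0
  have : cfc f X = cfc (fun _ : ℝ => (0 : ℝ)) X := cfc_congr fun t ht =>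
    hf0 t (neg_le_of_abs_le (abs_le_of_mem_spectrum X ht))
  rw [this, show (fun _ : ℝ => (0 : ℝ)) = 0 from rfl, cfc_zero]; rfl

theorem spectralSubspace_Ioi_eq_bot (X : H →L[ℂ] H) (hX : IsSelfAdjoint X) {x : ℝ}
    (hx : ‖X‖ ≤ x) : spectralSubspace X (Set.Ioi x) = ⊥ := by
  have : cfc (fun t : ℝ => max (t - x) 0) X = cfc (fun _ : ℝ => (0 : ℝ)) X := cfc_congr fun t ht =>
    max_eq_right (by have := le_of_abs_le (abs_le_of_mem_spectrum X ht); linarith)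
  rw [spectralSubspace_Ioi X hX, this, show (fun _ : ℝ => (0 : ℝ)) = 0 from rfl, cfc_zero]
  simp

theorem spectralProjection_mem {M : VonNeumannAlgebra H} {X : H →L[ℂ] H} (hX : X ∈ M)
    (B : Set ℝ) : spectralProjection X B ∈ M := by
  rw [VonNeumannAlgebra.IsStarProjection.mem_iff (isStarProjection_spectralProjection X B), range_spectralProjection]
  intro y hy
  have hXy : Commute X y := VonNeumannAlgebra.mem_commutant_iff.1 hy X hX
  rw [Module.End.mem_invtSubmodule]
  refine spectralSubspace_le X ?_ fun K hK hKB v hv => ?_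
  · exact (isClosed_spectralSubspace X B).preimage y.continuous
  · refine closedSpectralSubspace_le X hK hKB (x := y v) fun f hf hf0 => ?_
    have : cfc f X * y = y * cfc f X := hXy.cfc_real f
    have h2 : cfc f X (y v) = y (cfc f X v) := congr($this v)
    rw [h2, hv f hf hf0, map_zero]
end

section
variable {H : Type u} [NormedAddCommGroup H] [InnerProductSpace ℂ H]

theorem stronglyMeasurable_starProjection (W : ℝ → Submodule ℂ H)
    [∀ t, (W t).HasOrthogonalProjection] (hW : Antitone W) (v : H) :
    StronglyMeasurable fun t => (W t).starProjection v := by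
  have hmain : ∀ {a b : ℝ}, a ≤ b → ‖(W a).starProjection v - (W b).starProjection v‖ ^ 2 =
      ‖(W a).starProjection v‖ ^ 2 - ‖(W b).starProjection v‖ ^ 2 := by
    intro a b hab
    have h1 : (W b).starProjection ((W a).starProjection v) = (W b).starProjection v :=
      congr($(Submodule.starProjection_comp_starProjection_of_le (hW hab)) v)
    have h2 := Submodule.norm_sq_eq_add_norm_sq_starProjection ((W a).starProjection v) (W b)
    rw [h1, Submodule.starProjection_orthogonal_val, h1] at h2
    linarith
  have hanti : Antitone fun t => ‖(W t).starProjection v‖ ^ 2 := fun a b hab => by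
    have := hmain hab
    have h0 := sq_nonneg ‖(W a).starProjection v - (W b).starProjection v‖
    simp only; linarith
  refine StronglyMeasurable.of_countable_not_continuousAt
    (hanti.countable_not_continuousAt.mono fun t ht => ?_)
  refine fun hc => ht ?_
  have habs : ∀ s, ‖(W s).starProjection v - (W t).starProjection v‖ ^ 2 ≤
      |‖(W s).starProjection v‖ ^ 2 - ‖(W t).starProjection v‖ ^ 2| := by
    intro s
    rcases le_total s t with h | h
    · rw [hmain h]; exact le_abs_self _
    · rw [norm_sub_rev, hmain h, abs_sub_comm]; exact le_abs_self _
  have hlim : Tendsto (fun s => √|‖(W s).starProjection v‖ ^ 2 - ‖(W t).starProjection v‖ ^ 2|)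
      (𝓝 t) (𝓝 0) := by
    have h1 : Tendsto (fun s => ‖(W s).starProjection v‖ ^ 2 - ‖(W t).starProjection v‖ ^ 2)
        (𝓝 t) (𝓝 0) := by
      have h2 := hc.tendsto.sub_const (‖(W t).starProjection v‖ ^ 2)
      rwa [sub_self] at h2
    simpa [Function.comp_def] using (Real.continuous_sqrt.tendsto _).comp h1.abs
  refine tendsto_iff_norm_sub_tendsto_zero.2
    (squeeze_zero (fun _ => norm_nonneg _) (fun s => ?_) hlim)
  exact Real.le_sqrt_of_sq_le (habs s)

end

section
variable {H : Type u} [NormedAddCommGroup H] [InnerProductSpace ℂ H] [CompleteSpace H]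

theorem exists_weak_integral (W : ℝ → Submodule ℂ H)
    [∀ t, (W t).HasOrthogonalProjection] (hW : Antitone W) (R : ℝ) :
    ∃ Z : H →L[ℂ] H,
      (∀ v, inner ℂ v (Z v) =
        (((∫ t in (-R)..R, ‖(W t).starProjection v‖ ^ 2) - R * ‖v‖ ^ 2 : ℝ) : ℂ)) ∧
      ∀ T : H →L[ℂ] H, (∀ t, T * (W t).starProjection = (W t).starProjection * T) →
        T * Z = Z * T := by
  have hint : ∀ v : H, IntervalIntegrable (fun t => (W t).starProjection v) volume (-R) R := by
    intro v
    refine (intervalIntegrable_const (c := ‖v‖)).mono_fun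
      (stronglyMeasurable_starProjection W hW v).aestronglyMeasurable (Eventually.of_forall ?_)
    intro t
    simpa using (W t).norm_starProjection_apply_le v
  let Z₀ : H →L[ℂ] H := LinearMap.mkContinuous
    { toFun := fun v => ∫ t in (-R)..R, (W t).starProjection v
      map_add' := fun u v => by
        simp only [map_add]
        exact intervalIntegral.integral_add (hint u) (hint v)
      map_smul' := fun c v => by
        simp only [map_smul, RingHom.id_apply]
        exact intervalIntegral.integral_smul c _ } |R - -R| (fun v => by
      have := intervalIntegral.norm_integral_le_of_norm_le_const (a := -R) (b := R) (C := ‖v‖)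
        (f := fun t => (W t).starProjection v)
        fun t _ => (W t).norm_starProjection_apply_le v
      rw [mul_comm]; exact this)
  have hZ₀ : ∀ v, Z₀ v = ∫ t in (-R)..R, (W t).starProjection v := fun _ => rfl
  refine ⟨Z₀ - (R : ℂ) • 1, fun v => ?_, fun T hT => ?_⟩
  · have h1 : inner ℂ v (Z₀ v) = ∫ t in (-R)..R, inner ℂ v ((W t).starProjection v) := by
      rw [hZ₀]
      exact ((innerSL ℂ v).intervalIntegral_comp_comm (hint v)).symm
    have h2 : ∀ t, inner ℂ v ((W t).starProjection v) =
        ((‖(W t).starProjection v‖ ^ 2 : ℝ) : ℂ) := by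
      intro t
      have h3 : (W t).starProjection ((W t).starProjection v) = (W t).starProjection v :=
        Submodule.starProjection_eq_self_iff.2 (Submodule.starProjection_apply_mem _ _)
      rw [← h3, ← Submodule.inner_starProjection_left_eq_right, h3, inner_self_eq_norm_sq_to_K]
      push_cast; rfl
    simp only [h2] at h1
    rw [intervalIntegral.integral_ofReal] at h1
    have h4 : (Z₀ - (R : ℂ) • 1) v = Z₀ v - (R : ℂ) • v := rfl
    rw [h4, inner_sub_right, h1, inner_smul_right, inner_self_eq_norm_sq_to_K]
    push_cast; rfl
  · have h1 : T * Z₀ = Z₀ * T := by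
      ext v
      have h2 : T (Z₀ v) = Z₀ (T v) := by
        rw [hZ₀, hZ₀, ← T.intervalIntegral_comp_comm (hint v)]
        congr 1
        funext t
        exact congr($(hT t) v)
      exact h2
    rw [mul_sub, sub_mul, h1]
    simp

theorem exists_spectralSubspace_eq (W : ℝ → Submodule ℂ H)
    [∀ t, (W t).HasOrthogonalProjection] (hW : Antitone W)
    (hrc : ∀ x, ∀ S : Submodule ℂ H, IsClosed (S : Set H) → (∀ s > x, W s ≤ S) → W x ≤ S)
    (R : ℝ) (hR : 0 ≤ R) (htop : ∀ t < -R, W t = ⊤) (hbot : ∀ t ≥ R, W t = ⊥) :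
    ∃ Z : H →L[ℂ] H, IsSelfAdjoint Z ∧
      (∀ T : H →L[ℂ] H, (∀ t, T * (W t).starProjection = (W t).starProjection * T) →
        T * Z = Z * T) ∧
      ∀ x, spectralSubspace Z (Set.Ioi x) = W x := by
  obtain ⟨Z, hq, hcomm⟩ := exists_weak_integral W hW R
  set q : H → ℝ := fun v => (∫ t in (-R)..R, ‖(W t).starProjection v‖ ^ 2) - R * ‖v‖ ^ 2 with hqdef
  have hZ : IsSelfAdjoint Z := by
    rw [ContinuousLinearMap.isSelfAdjoint_iff_isSymmetric, LinearMap.isSymmetric_iff_inner_map_self_real]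
    intro v
    have h : inner ℂ v (Z v) = (q v : ℂ) := hq v
    have h' : inner ℂ (Z v) v = (q v : ℂ) := by rw [← inner_conj_symm, h, Complex.conj_ofReal]
    show (starRingEnd ℂ) (inner ℂ (Z v) v) = inner ℂ (Z v) v
    rw [h', Complex.conj_ofReal]
  refine ⟨Z, hZ, hcomm, fun x => ?_⟩
  -- monotonicity and integrability of the quadratic forms
  have hanti : ∀ v, Antitone fun t => ‖(W t).starProjection v‖ ^ 2 := fun v a b hab => by
    have h1 : (W b).starProjection ((W a).starProjection v) = (W b).starProjection v :=
      congr($(Submodule.starProjection_comp_starProjection_of_le (hW hab)) v)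
    have h2 := (W b).norm_starProjection_apply_le ((W a).starProjection v)
    rw [h1] at h2
    simp only; gcongr
  have hii : ∀ v a b, IntervalIntegrable (fun t => ‖(W t).starProjection v‖ ^ 2) volume a b :=
    fun v a b => (hanti v).intervalIntegrable
  have hle : ∀ v t, ‖(W t).starProjection v‖ ^ 2 ≤ ‖v‖ ^ 2 := fun v t => by
    have := (W t).norm_starProjection_apply_le v
    gcongr
  have hub : ∀ v a b, a ≤ b → ∫ t in a..b, ‖(W t).starProjection v‖ ^ 2 ≤ (b - a) * ‖v‖ ^ 2 := by
    intro v a b hab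
    have := intervalIntegral.integral_mono_on hab (hii v a b)
      (intervalIntegrable_const (c := ‖v‖ ^ 2)) fun t _ => hle v t
    simpa using this
  have hnn : ∀ v a b, a ≤ b → 0 ≤ ∫ t in a..b, ‖(W t).starProjection v‖ ^ 2 := fun v a b hab =>
    intervalIntegral.integral_nonneg hab fun t _ => sq_nonneg _
  have hq1 : ∀ v, (W x).starProjection v = 0 → q v ≤ x * ‖v‖ ^ 2 := by
    intro v hv
    rcases lt_or_ge x (-R) with h | h
    · have : v = 0 := by
        have hvm : v ∈ W x := by rw [htop x h]; trivial
        rw [← Submodule.starProjection_eq_self_iff.2 hvm, hv]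
      simp [hqdef, this]
    rcases le_total R x with h' | h'
    · have h1 := hub v (-R) R (by linarith)
      have h2 : R * ‖v‖ ^ 2 ≤ x * ‖v‖ ^ 2 := by gcongr
      simp only [hqdef]; linarith
    · have h1 := hub v (-R) x h
      have h2 : ∫ t in x..R, ‖(W t).starProjection v‖ ^ 2 = 0 := by
        rw [intervalIntegral.integral_congr (g := fun _ => (0 : ℝ))]
        · simp
        · intro t ht
          rw [Set.uIcc_of_le h'] at ht
          have h3 := hanti v ht.1
          simp only [hv, norm_zero] at h3
          exact le_antisymm (by simpa using h3) (sq_nonneg _)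
      simp only [hqdef]
      rw [← intervalIntegral.integral_add_adjacent_intervals (hii v (-R) x) (hii v x R), h2]
      linarith
  have hq2 : ∀ v, (W x).starProjection v = v → q v ≤ x * ‖v‖ ^ 2 →
      ∀ s > x, (W s).starProjection v = 0 := by
    intro v hv hqv s hs
    rcases le_or_gt R s with h | h
    · rw [Submodule.starProjection_apply_eq_zero_iff, hbot s h]; simp
    rcases lt_or_ge x (-R) with h' | h'
    · have h1 := hnn v (-R) R (by linarith)
      simp only [hqdef] at hqv
      have h2 : (x + R) * ‖v‖ ^ 2 ≥ 0 := by linarith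
      have h3 : ‖v‖ ^ 2 ≤ 0 := by
        by_contra! h4
        nlinarith
      have h4 : v = 0 := by simpa using le_antisymm h3 (sq_nonneg _)
      rw [h4, map_zero]
    · have h1 : ∫ t in (-R)..x, ‖(W t).starProjection v‖ ^ 2 = (x + R) * ‖v‖ ^ 2 := by
        rw [intervalIntegral.integral_congr (g := fun _ => ‖v‖ ^ 2)]
        · simp
        · intro t ht
          rw [Set.uIcc_of_le h'] at ht
          have hvm : v ∈ W t := hW ht.2 (Submodule.starProjection_eq_self_iff.1 hv)
          simp only [Submodule.starProjection_eq_self_iff.2 hvm]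
      have h2 : (s - x) * ‖(W s).starProjection v‖ ^ 2 ≤
          ∫ t in x..s, ‖(W t).starProjection v‖ ^ 2 := by
        have := intervalIntegral.integral_mono_on hs.le
          (intervalIntegrable_const (c := ‖(W s).starProjection v‖ ^ 2)) (hii v x s)
          fun t ht => hanti v ht.2
        simpa using this
      have h3 := hnn v s R h.le
      simp only [hqdef] at hqv
      rw [← intervalIntegral.integral_add_adjacent_intervals (hii v (-R) x) (hii v x R),
        ← intervalIntegral.integral_add_adjacent_intervals (hii v x s) (hii v s R), h1] at hqv
      have h4 : (s - x) * ‖(W s).starProjection v‖ ^ 2 ≤ 0 := by linarith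
      have h5 : ‖(W s).starProjection v‖ ^ 2 ≤ 0 := by
        by_contra! h6
        have : 0 < s - x := by linarith
        nlinarith [mul_pos this h6]
      simpa using le_antisymm h5 (sq_nonneg _)
  -- the positive and negative parts of Z - x
  have hWx : (W x)ᗮᗮ = W x := Submodule.orthogonal_orthogonal _
  rw [spectralSubspace_Ioi Z hZ, ← hWx]
  congr 1
  set A : H →L[ℂ] H := cfc (fun t : ℝ => max (t - x) 0) Z with hA
  obtain ⟨B, S, hBpos, hSsa, hSS, hAB, hBA⟩ : ∃ B S : H →L[ℂ] H, B.IsPositive ∧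
      ContinuousLinearMap.adjoint S = S ∧ A = S * S ∧ A - B = Z - (x : ℂ) • 1 ∧ B * A = 0 := by
    refine ⟨cfc (fun t : ℝ => max (x - t) 0) Z, cfc (fun t : ℝ => √(max (t - x) 0)) Z,
      ?_, ?_, ?_, ?_, ?_⟩
    · exact (ContinuousLinearMap.nonneg_iff_isPositive _).1 (cfc_nonneg fun t _ => le_max_right _ _)
    · have : IsSelfAdjoint (cfc (fun t : ℝ => √(max (t - x) 0)) Z) := cfc_predicate _ Z
      exact this
    · rw [hA, ← cfc_mul _ _ Z (by fun_prop) (by fun_prop)]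
      congr 1
      funext t
      rw [Real.mul_self_sqrt (le_max_right _ _)]
    · rw [hA, ← cfc_sub _ _ Z (by fun_prop) (by fun_prop)]
      have h1 : (fun t : ℝ => max (t - x) 0 - max (x - t) 0) = fun t => id t - x := by
        funext t
        rcases le_total t x with h | h
        · rw [max_eq_right (by linarith), max_eq_left (by linarith)]; simp
        · rw [max_eq_left (by linarith), max_eq_right (by linarith)]; simp
      rw [h1, cfc_sub _ _ Z (by fun_prop) (by fun_prop), cfc_id ℝ Z, cfc_const x Z,
        Algebra.algebraMap_eq_smul_one]
      rfl
    · rw [hA, ← cfc_mul _ _ Z (by fun_prop) (by fun_prop)]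
      have h1 : (fun t : ℝ => max (x - t) 0 * max (t - x) 0) = 0 := by
        funext t
        rcases le_total t x with h | h
        · rw [max_eq_right (a := t - x) (by linarith)]; simp
        · rw [max_eq_right (a := x - t) (by linarith)]; simp
      rw [h1, cfc_zero]
  have hPA : ∀ v, A ((W x).starProjection v) = (W x).starProjection (A v) := by
    intro v
    have h1 : (W x).starProjection * Z = Z * (W x).starProjection := by
      refine hcomm _ fun t => ?_
      rcases le_total t x with h | h
      · have h2 : (W t).starProjection * (W x).starProjection = (W x).starProjection := by
          ext u
          exact Submodule.starProjection_eq_self_iff.2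
            (hW h (Submodule.starProjection_apply_mem _ _))
        have h3 : (W x).starProjection * (W t).starProjection = (W x).starProjection :=
          Submodule.starProjection_comp_starProjection_of_le (hW h)
        rw [h2, h3]
      · have h2 : (W x).starProjection * (W t).starProjection = (W t).starProjection := by
          ext u
          exact Submodule.starProjection_eq_self_iff.2
            (hW h (Submodule.starProjection_apply_mem _ _))
        have h3 : (W t).starProjection * (W x).starProjection = (W t).starProjection :=
          Submodule.starProjection_comp_starProjection_of_le (hW h)
        rw [h2, h3]
    have h2 : Commute Z (W x).starProjection := h1.symm
    exact congr($(h2.cfc_real fun t : ℝ => max (t - x) 0) v)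
  have hZv : ∀ v, Z v = A v - B v + (x : ℂ) • v := by
    intro v
    have h1 : A v - B v = Z v - (x : ℂ) • v := congr($hAB v)
    rw [h1]; simp
  have hre : ∀ v, (inner ℂ v (Z v)).re = q v := fun v => by rw [hq v, Complex.ofReal_re]
  have hxv : ∀ v : H, (inner ℂ v ((x : ℂ) • v)).re = x * ‖v‖ ^ 2 := fun v => by
    have h1 : inner ℂ v ((x : ℂ) • v) = ((x * ‖v‖ ^ 2 : ℝ) : ℂ) := by
      rw [inner_smul_right, inner_self_eq_norm_sq_to_K]
      push_cast; rfl
    rw [h1, Complex.ofReal_re]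
  have hAS : ∀ v, (inner ℂ v (A v)).re = ‖S v‖ ^ 2 := by
    intro v
    have h1 : A v = S (S v) := congr($hSS v)
    have h2 : inner ℂ v (A v) = ((‖S v‖ ^ 2 : ℝ) : ℂ) := by
      rw [h1, ← ContinuousLinearMap.adjoint_inner_left, hSsa, inner_self_eq_norm_sq_to_K]
      push_cast; rfl
    rw [h2, Complex.ofReal_re]
  have hAzero : ∀ v, A (A v) = 0 → A v = 0 := by
    intro v hv
    have hAsa : ContinuousLinearMap.adjoint A = A := by
      have : IsSelfAdjoint A := cfc_predicate _ Z
      exact this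
    have : inner ℂ (A v) (A v) = (0 : ℂ) := by
      rw [← ContinuousLinearMap.adjoint_inner_left, hAsa, hv, inner_zero_left]
    simpa using this
  ext v
  constructor
  · intro hv
    have hv : A v = 0 := hv
    set w := (W x).starProjection v with hw
    have hpw : (W x).starProjection w = w :=
      Submodule.starProjection_eq_self_iff.2 (Submodule.starProjection_apply_mem _ _)
    have hAw : A w = 0 := by rw [hw, hPA, hv, map_zero]
    have h1 : q w ≤ x * ‖w‖ ^ 2 := by
      rw [← hre, hZv, hAw, inner_add_right, Complex.add_re, hxv, zero_sub, inner_neg_right]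
      have h2 : 0 ≤ (inner ℂ w (B w)).re := hBpos.re_inner_nonneg_right w
      simp only [Complex.neg_re]; linarith
    have h2 := hq2 w hpw h1
    have h3 : W x ≤ (Submodule.span ℂ {w})ᗮ := by
      refine hrc x _ (Submodule.isClosed_orthogonal _) fun s hs => ?_
      rw [Submodule.le_orthogonal_iff_le_orthogonal, Submodule.span_singleton_le_iff_mem]
      exact (Submodule.starProjection_apply_eq_zero_iff _).1 (h2 s hs)
    have h4 : w ∈ (Submodule.span ℂ {w})ᗮ := h3 (Submodule.starProjection_apply_mem _ _)
    have h5 : w = 0 := by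
      rw [Submodule.mem_orthogonal_singleton_iff_inner_right] at h4
      simpa using h4
    exact (Submodule.starProjection_apply_eq_zero_iff _).1 h5
  · intro hv
    have hv : (W x).starProjection v = 0 := (Submodule.starProjection_apply_eq_zero_iff _).2 hv
    have hpu : (W x).starProjection (A v) = 0 := by rw [← hPA, hv, map_zero]
    have h1 := hq1 (A v) hpu
    have hB : B (A v) = 0 := congr($hBA v)
    rw [← hre, hZv, hB, sub_zero, inner_add_right, Complex.add_re, hxv, hAS] at h1
    have h2 : ‖S (A v)‖ ^ 2 ≤ 0 := by linarith
    have h3 : S (A v) = 0 := by simpa using le_antisymm h2 (sq_nonneg _)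
    have h4 : A (A v) = 0 := by
      have : A (A v) = S (S (A v)) := congr($hSS (A v))
      rw [this, h3, map_zero]
    exact hAzero v h4
end

section
variable {H : Type u} [NormedAddCommGroup H] [InnerProductSpace ℂ H] [CompleteSpace H]

/-- `P ∨ Q`: the orthogonal projection onto the closure of `PH + QH`. -/
noncomputable def projectionSup (P Q : H →L[ℂ] H) : H →L[ℂ] H :=
  (P.range ⊔ Q.range).topologicalClosure.starProjection

theorem projectionSup_mem {M : VonNeumannAlgebra H} {P Q : H →L[ℂ] H} (hP : P ∈ M)
    (hQ : Q ∈ M) : projectionSup P Q ∈ M := by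
  have hs : IsStarProjection (projectionSup P Q) := isStarProjection_starProjection
  have hr : (projectionSup P Q).range = (P.range ⊔ Q.range).topologicalClosure :=
    Submodule.range_starProjection _
  rw [VonNeumannAlgebra.IsStarProjection.mem_iff hs, hr]
  intro y hy
  have hmem : ∀ T ∈ M, ∀ u, y (T u) ∈ T.range := fun T hT u => by
    have h1 : T * y = y * T := VonNeumannAlgebra.mem_commutant_iff.1 hy T hT
    exact ⟨y u, congr($h1 u)⟩
  rw [Module.End.mem_invtSubmodule]
  refine Submodule.topologicalClosure_minimal _ (sup_le ?_ ?_)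
    ((Submodule.isClosed_topologicalClosure _).preimage y.continuous)
  · rintro _ ⟨u, rfl⟩
    exact Submodule.le_topologicalClosure _ (Submodule.mem_sup_left (hmem P hP u))
  · rintro _ ⟨u, rfl⟩
    exact Submodule.le_topologicalClosure _ (Submodule.mem_sup_right (hmem Q hQ u))

theorem exists_spectralSup (M : VonNeumannAlgebra H) (X Y : selfAdjoint M.toStarSubalgebra) :
    ∃ Z : selfAdjoint M.toStarSubalgebra, ∀ x : ℝ,
      spectralProjection (Z : H →L[ℂ] H) (Set.Ioi x) =
        projectionSup (spectralProjection (X : H →L[ℂ] H) (Set.Ioi x))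
          (spectralProjection (Y : H →L[ℂ] H) (Set.Ioi x)) := by
  set GX : ℝ → Submodule ℂ H := fun t => spectralSubspace (X : H →L[ℂ] H) (Set.Ioi t) with hGX
  set GY : ℝ → Submodule ℂ H := fun t => spectralSubspace (Y : H →L[ℂ] H) (Set.Ioi t) with hGY
  have hXs : IsSelfAdjoint (X : H →L[ℂ] H) := congr_arg Subtype.val X.2
  have hYs : IsSelfAdjoint (Y : H →L[ℂ] H) := congr_arg Subtype.val Y.2
  let W : ℝ → Submodule ℂ H := fun t => (GX t ⊔ GY t).topologicalClosure
  have _inst : ∀ t, (W t).HasOrthogonalProjection := fun t =>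
    inferInstanceAs (GX t ⊔ GY t).topologicalClosure.HasOrthogonalProjection
  have hWP : ∀ t, (W t).starProjection =
      projectionSup (spectralProjection (X : H →L[ℂ] H) (Set.Ioi t))
          (spectralProjection (Y : H →L[ℂ] H) (Set.Ioi t)) := fun t => by
    simp only [projectionSup, range_spectralProjection]
    rfl
  have hXW : ∀ t, GX t ≤ W t := fun t => le_sup_left.trans (Submodule.le_topologicalClosure _)
  have hYW : ∀ t, GY t ≤ W t := fun t => le_sup_right.trans (Submodule.le_topologicalClosure _)
  have hWle : ∀ t (S : Submodule ℂ H), IsClosed (S : Set H) → GX t ≤ S → GY t ≤ S → W t ≤ S :=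
    fun t S hS h1 h2 => Submodule.topologicalClosure_minimal _ (sup_le h1 h2) hS
  have hanti : Antitone W := fun a b hab => hWle b _ (Submodule.isClosed_topologicalClosure _)
    ((spectralSubspace_mono _ (Set.Ioi_subset_Ioi hab)).trans (hXW a))
    ((spectralSubspace_mono _ (Set.Ioi_subset_Ioi hab)).trans (hYW a))
  obtain ⟨Z, hZ, hcomm, hE⟩ := exists_spectralSubspace_eq W hanti
    (fun x S hS h => hWle x S hS
      (spectralSubspace_Ioi_le _ x hS fun s hs => (hXW s).trans (h s hs))
      (spectralSubspace_Ioi_le _ x hS fun s hs => (hYW s).trans (h s hs)))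
    (max ‖(X : H →L[ℂ] H)‖ ‖(Y : H →L[ℂ] H)‖) (le_max_of_le_left (norm_nonneg _))
    (fun t ht => by
      rw [eq_top_iff, ← spectralSubspace_Ioi_eq_top (X : H →L[ℂ] H) (x := t)
        (by have := le_max_left ‖(X : H →L[ℂ] H)‖ ‖(Y : H →L[ℂ] H)‖; linarith)]
      exact hXW t)
    (fun t ht => by
      rw [eq_bot_iff]
      exact hWle t ⊥ isClosed_singleton
        (spectralSubspace_Ioi_eq_bot _ hXs ((le_max_left _ _).trans ht)).le
        (spectralSubspace_Ioi_eq_bot _ hYs ((le_max_right _ _).trans ht)).le)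
  have hZM : Z ∈ M := by
    rw [← VonNeumannAlgebra.commutant_commutant M, VonNeumannAlgebra.mem_commutant_iff]
    intro T hT
    refine hcomm T fun t => ?_
    rw [hWP]
    exact (VonNeumannAlgebra.mem_commutant_iff.1 hT _ (projectionSup_mem
      (spectralProjection_mem X.1.2 _) (spectralProjection_mem Y.1.2 _))).symm
  refine ⟨⟨⟨Z, hZM⟩, Subtype.ext hZ⟩, fun x => ?_⟩
  have h : (spectralSubspace Z (Set.Ioi x)).starProjection = (W x).starProjection :=
    Submodule.starProjection_inj.2 (hE x)
  exact h.trans (hWP x)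

/-- The spectral projection `E_X(B)` of `X ∈ M_sa`, as an element of `M`. -/
noncomputable def spectralE {M : VonNeumannAlgebra H} (X : selfAdjoint M.toStarSubalgebra)
    (B : Set ℝ) : M.toStarSubalgebra :=
  ⟨spectralProjection (X : H →L[ℂ] H) B, spectralProjection_mem X.1.2 B⟩

/-- The maximum `X ∨ Y` of `X, Y ∈ M_sa` for the spectral order: the (unique) element of `M_sa`
such that `E_{X ∨ Y}((x, ∞)) = E_X((x, ∞)) ∨ E_Y((x, ∞))` for all real `x`. -/
noncomputable def spectralSup {M : VonNeumannAlgebra H} (X Y : selfAdjoint M.toStarSubalgebra) :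
    selfAdjoint M.toStarSubalgebra :=
  Classical.choose (exists_spectralSup M X Y)

theorem spectralProjection_spectralSup {M : VonNeumannAlgebra H}
    (X Y : selfAdjoint M.toStarSubalgebra) (x : ℝ) :
    spectralProjection (spectralSup X Y : H →L[ℂ] H) (Set.Ioi x) =
      projectionSup (spectralProjection (X : H →L[ℂ] H) (Set.Ioi x))
        (spectralProjection (Y : H →L[ℂ] H) (Set.Ioi x)) :=
  Classical.choose_spec (exists_spectralSup M X Y) x

/-- `spectralMax U n = U 0 ∨ ⋯ ∨ U (n - 1)`, the maximum of the first `n` terms of the sequence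
`U` for the spectral order (the value at `n = 0` is a convention that plays no role). -/
noncomputable def spectralMax {M : VonNeumannAlgebra H} (U : ℕ → selfAdjoint M.toStarSubalgebra) :
    ℕ → selfAdjoint M.toStarSubalgebra
  | 0 => 0
  | 1 => U 0
  | n + 2 => spectralSup (spectralMax U (n + 1)) (U (n + 1))

/-- `τ` is a faithful normal tracial state on the von Neumann algebra `M`, so that `(M, τ)` is a
tracial W*-probability space. Normality: `τ` preserves suprema of increasing nets of selfadjoint
elements, for the usual operator order. -/
structure IsFaithfulNormalTracialState {M : VonNeumannAlgebra H}
    (τ : M.toStarSubalgebra →ₗ[ℂ] ℂ) : Prop where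
  map_one : τ 1 = 1
  nonneg : ∀ x, 0 ≤ τ (star x * x)
  tracial : ∀ x y, τ (x * y) = τ (y * x)
  faithful : ∀ x, τ (star x * x) = 0 → x = 0
  normal : ∀ (S : Set M.toStarSubalgebra) (a : M.toStarSubalgebra), S.Nonempty →
    DirectedOn (· ≤ ·) S → (∀ s ∈ S, IsSelfAdjoint s) → IsLUB S a →
    IsLUB ((fun s => (τ s).re) '' S) (τ a).re

/-- The von Neumann algebra `W*(X)` generated by the operator `X`: the bicommutant of
`{X, X*}`. -/
def generatedVonNeumann (X : H →L[ℂ] H) : Set (H →L[ℂ] H) :=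
  Set.centralizer (Set.centralizer {X, star X})

/-- Free independence of the family `X` of selfadjoint elements of `(M, τ)`, that is, of the von
Neumann algebras `W*(X i)`: for `m ≥ 1`, `i₁ ≠ i₂ ≠ ⋯ ≠ i_m` (neighbours distinct) and
`a_j ∈ W*(X i_j)` with `τ(a_j) = 0`, one has `τ(a₁ a₂ ⋯ a_m) = 0`. -/
def FreelyIndependent {M : VonNeumannAlgebra H} (τ : M.toStarSubalgebra →ₗ[ℂ] ℂ) {ι : Type*}
    (X : ι → selfAdjoint M.toStarSubalgebra) : Prop :=
  ∀ l : List (ι × M.toStarSubalgebra), l ≠ [] → l.IsChain (fun p q => p.1 ≠ q.1) →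
    (∀ p ∈ l, (p.2 : H →L[ℂ] H) ∈ generatedVonNeumann (X p.1 : H →L[ℂ] H) ∧ τ p.2 = 0) →
    τ (l.map Prod.snd).prod = 0

/-- The real number `τ(E_X(B))`. -/
noncomputable def spectralDistribution {M : VonNeumannAlgebra H}
    (τ : M.toStarSubalgebra →ₗ[ℂ] ℂ) (X : selfAdjoint M.toStarSubalgebra) (B : Set ℝ) : ℝ :=
  (τ (spectralE X B)).re

/-- `X ∼ μ`: the (spectral) distribution `B ↦ τ(E_X(B))` of `X` is the measure `μ`. -/
def HasSpectralLaw {M : VonNeumannAlgebra H} (τ : M.toStarSubalgebra →ₗ[ℂ] ℂ)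
    (X : selfAdjoint M.toStarSubalgebra) (μ : Measure ℝ) : Prop :=
  ∀ B : Set ℝ, MeasurableSet B → spectralDistribution τ X B = μ.real B

end

/-- The uniform distribution `U(0,1)`. -/
noncomputable def uniform01 : Measure ℝ := volume.restrict (Set.Ioo 0 1)

/-- `F` is the distribution function of a probability measure on `ℝ`. -/
structure IsDistributionFunction (F : ℝ → ℝ) : Prop where
  mono : Monotone F
  right_continuous : ∀ x, ContinuousWithinAt F (Set.Ici x) x
  tendsto_atBot : Tendsto F atBot (𝓝 0)
  tendsto_atTop : Tendsto F atTop (𝓝 1)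

/-- Weak convergence of functions on `ℝ` to `G`: convergence at every continuity point of `G`. -/
def ConvergesWeakly (Gn : ℕ → ℝ → ℝ) (G : ℝ → ℝ) : Prop :=
  ∀ x, ContinuousAt G x → Tendsto (fun n => Gn n x) atTop (𝓝 (G x))

/-- The function `Λ^∨` on `[0,1]`. -/
noncomputable def lambdaMax (y : ℝ) : ℝ := if y = 0 then 0 else max 0 (1 + Real.log y)

/-- Gumbel distribution function. -/
noncomputable def gumbel (x : ℝ) : ℝ := Real.exp (-Real.exp (-x))

/-- Fréchet distribution function. -/
noncomputable def frechet (α x : ℝ) : ℝ := if 0 < x then Real.exp (-x ^ (-α)) else 0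

/-- Weibull distribution function. -/
noncomputable def weibull (α x : ℝ) : ℝ := if x ≤ 0 then Real.exp (-(-x) ^ α) else 1

/-- Exponential distribution function (free Gumbel type). -/
noncomputable def freeGumbel (x : ℝ) : ℝ := max 0 (1 - Real.exp (-x))

/-- Pareto distribution function (free Fréchet type). -/
noncomputable def freeFrechet (α x : ℝ) : ℝ := if 0 < x then max 0 (1 - x ^ (-α)) else 0

/-- Beta law distribution function (free Weibull type). -/
noncomputable def freeWeibull (α x : ℝ) : ℝ :=
  if x < -1 then 0 else if x ≤ 0 then 1 - |x| ^ α else 1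

/-! A vector lies in the range of $E_{\tilde U_n}([0,y])$ exactly when every $P_i =
E_{U_i}((y,\infty))$ kills it. The $P_i$ are free projections of trace $p = 1-y$, so all reduces to
`trace_iInf_ker`: the projection $K$ onto the common kernel of $N$ free projections of trace $p$ has
trace $\max(0, 1-Np)$. With $y = c^{1/n}$, the limit $n(1-c^{1/n}) \to -\log c$ then produces
$\Lambda^\lor(c)$.

For the trace, put $T = 1 - \frac1N\sum P_i$. This is a positive contraction whose fixed vectors
form the common kernel, so the Abel means $(1-x)(1-xT)^{-1}$ decrease strongly to $K$ as $x \uparrow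
1$ (`tendsto_cfc_resolventFun`), and normality gives $h(x) = (1-x)\tau((1-xT)^{-1}) \to \tau(K)$.

The function $h$ is computed from freeness. For small $s$ and $c_i = s(P_i-p)$, let $W$ be $1$ plus
the sum of all alternating words in the $c_i$. It inverts $\sum(1+c_i)^{-1}-(N-1)$, and $\tau(W)=1$
since every alternating word has trace zero (`exists_right_inverse_of_alternating`). As $P_i$ is
idempotent, $(1+c_i)^{-1}$ is affine in $P_i$, so $W$ is a multiple of a resolvent of $\sum P_i$.
This parametrizes $h$ rationally by $s$ near $0$; eliminating $s$ gives a quadratic equation, which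
the identity theorem carries to the whole disc (`resolvent_relation`). At $x = 1$ it reads
$L(L-1+Np)=0$, and signs before the limit select the root (`eq_max_of_resolvent_relation`). -/

/-! ### Series of alternating words in a Banach algebra -/

section AlternatingSeries

variable {A : Type*} [NormedRing A] {ι : Type*} [Fintype ι] [DecidableEq ι]

/-- `alternatingSum c m i` is the sum of all products `c i₀ * c i₁ * ⋯ * c iₘ` with `i₀ = i` and
distinct neighbouring indices. -/
def alternatingSum (c : ι → A) : ℕ → ι → A
  | 0, i => c i
  | m + 1, i => c i * ∑ j ∈ Finset.univ.erase i, alternatingSum c m j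

/-- There are at most $n^m$ words of $m+1$ letters with a given first letter, which yields a
geometric bound. -/
theorem norm_alternatingSum_le (c : ι → A) {ε : ℝ} (hc : ∀ i, ‖c i‖ ≤ ε) (m : ℕ) (i : ι) :
    ‖alternatingSum c m i‖ ≤ ε * (Fintype.card ι * ε) ^ m := by
  have hε : 0 ≤ ε := (norm_nonneg _).trans (hc i)
  induction m generalizing i with
  | zero => simpa [alternatingSum] using hc i
  | succ m ih =>
    have h1 : ‖∑ j ∈ Finset.univ.erase i, alternatingSum c m j‖ ≤
        Fintype.card ι * (ε * (Fintype.card ι * ε) ^ m) := by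
      refine (norm_sum_le _ _).trans ?_
      refine (Finset.sum_le_card_nsmul _ _ _ fun j _ => ih j).trans ?_
      rw [nsmul_eq_mul]
      gcongr
      exact Finset.card_le_univ _
    calc ‖alternatingSum c (m + 1) i‖ ≤ ‖c i‖ * ‖∑ j ∈ Finset.univ.erase i, alternatingSum c m j‖ :=
          norm_mul_le _ _
      _ ≤ ε * (Fintype.card ι * (ε * (Fintype.card ι * ε) ^ m)) := by
          gcongr
          exact hc i
      _ = _ := by ring

/-- The prefix `l` makes the induction work: expanding one level of the recursion moves the letter
`i` from the sum into the prefix, until a single word is left. -/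
theorem map_mul_alternatingSum_eq_zero {B F : Type*} [AddCommMonoid B] [FunLike F A B]
    [AddMonoidHomClass F A B] (φ : F) (c : ι → A)
    (hφ : ∀ l : List ι, l ≠ [] → l.IsChain (· ≠ ·) → φ (l.map c).prod = 0) (m : ℕ) (l : List ι)
    (i : ι) (hl : (l ++ [i]).IsChain (· ≠ ·)) :
    φ ((l.map c).prod * alternatingSum c m i) = 0 := by
  induction m generalizing l i with
  | zero => simpa [alternatingSum] using hφ _ (by simp) hl
  | succ m ih =>
    have h1 : (l.map c).prod * alternatingSum c (m + 1) i =
        ∑ j ∈ Finset.univ.erase i, ((l ++ [i]).map c).prod * alternatingSum c m j := by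
      rw [← Finset.mul_sum, alternatingSum]
      simp [mul_assoc]
    rw [h1, map_sum]
    refine Finset.sum_eq_zero fun j hj => ih _ _ ?_
    rw [List.isChain_append]
    refine ⟨hl, List.isChain_singleton _, ?_⟩
    simpa using (Finset.ne_of_mem_erase hj).symm

/-- If all alternating products of the small elements `c i` are annihilated by the functional `φ`,
then the inverse `W` of `∑ (1 + c i)⁻¹ - (n - 1)` satisfies `φ W = φ 1`. -/
theorem exists_right_inverse_of_alternating [CompleteSpace A] [NormedAlgebra ℂ A] (φ : A →L[ℂ] ℂ)
    (c e : ι → A) {ε : ℝ} (hc : ∀ i, ‖c i‖ ≤ ε) (hε : Fintype.card ι * ε < 1) (hε0 : 0 ≤ ε)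
    (he : ∀ i, e i * (1 + c i) = 1)
    (hφ : ∀ l : List ι, l ≠ [] → l.IsChain (· ≠ ·) → φ (l.map c).prod = 0) :
    ∃ W : A, (∑ i, e i - (Fintype.card ι - 1 : A)) * W = 1 ∧ φ W = φ 1 := by
  have hsum : ∀ i, Summable fun m => alternatingSum c m i := fun i => by
    refine Summable.of_norm_bounded (g := fun m => ε * (Fintype.card ι * ε) ^ m) ?_
      fun m => norm_alternatingSum_le c hc m i
    exact (summable_geometric_of_lt_one (by positivity) hε).mul_left ε
  set t : ι → A := fun i => ∑' m, alternatingSum c m i with ht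
  -- A word starting with `i` is either that letter alone or that letter followed by a word starting
  -- elsewhere.
  have hrec : ∀ i, t i = c i + c i * ∑ j ∈ Finset.univ.erase i, t j := by
    intro i
    rw [ht]
    simp only
    rw [(hsum i).tsum_eq_zero_add, ← Summable.tsum_finsetSum fun j _ => hsum j,
      ← Summable.tsum_mul_left _ (summable_sum fun j _ => hsum j)]
    rfl
  set W : A := 1 + ∑ i, t i with hW
  -- `W - t i` collects the words, empty one included, that do not start with `i`; multiplying by `c
  -- i` gives those that do, so `1 + c i` maps it to `W`. Summing over `i` leaves an equation in `W`
  -- alone.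
  have hWt : ∀ i, W - t i = e i * W := by
    intro i
    have h1 : (1 + c i) * (W - t i) = W := by
      have h2 : W - t i = 1 + ∑ j ∈ Finset.univ.erase i, t j := by
        rw [hW, ← Finset.add_sum_erase _ _ (Finset.mem_univ i)]; abel
      calc (1 + c i) * (W - t i) = (W - t i) + c i * (W - t i) := by rw [add_mul, one_mul]
        _ = (W - t i) + (c i + c i * ∑ j ∈ Finset.univ.erase i, t j) := by
          conv_lhs => rw [h2, mul_add, mul_one]
          rw [h2]
        _ = W := by rw [← hrec i, sub_add_cancel]
    calc W - t i = e i * (1 + c i) * (W - t i) := by rw [he, one_mul]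
      _ = e i * W := by rw [mul_assoc, h1]
  refine ⟨W, ?_, ?_⟩
  · rw [sub_mul, Finset.sum_mul, ← Finset.sum_congr rfl fun i _ => hWt i, Finset.sum_sub_distrib,
      Finset.sum_const, Finset.card_univ, nsmul_eq_mul, sub_mul, one_mul]
    rw [show ∑ i, t i = W - 1 by rw [hW]; abel]
    abel
  · have h0 : ∀ i, φ (t i) = 0 := fun i => by
      rw [ht]
      simp only
      rw [φ.map_tsum (hsum i)]
      have h1 : ∀ m, φ (alternatingSum c m i) = 0 := fun m => by
        simpa using map_mul_alternatingSum_eq_zero φ c hφ m [] i (by simp)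
      simp [h1]
    rw [hW, map_add, map_sum, Finset.sum_eq_zero fun i _ => h0 i, add_zero]

end AlternatingSeries

/-! ### The moment relation of a free family -/

section AlternatingCentered

variable {A : Type*} [NormedRing A] [NormedAlgebra ℂ A] {ι : Type*}

/-- The functional `φ` vanishes on the alternating products of the elements `P i - p`: the moment
relation of a free family of elements with common mean `p`. -/
def AlternatingCentered (φ : A →L[ℂ] ℂ) (P : ι → A) (p : ℂ) : Prop :=
  ∀ l : List ι, l ≠ [] → l.IsChain (· ≠ ·) →
    φ (l.map fun i => P i - algebraMap ℂ A p).prod = 0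

theorem AlternatingCentered.map_smul {φ : A →L[ℂ] ℂ} {P : ι → A} {p : ℂ}
    (h : AlternatingCentered φ P p) (s : ℂ) (l : List ι) (hl : l ≠ [])
    (hc : l.IsChain (· ≠ ·)) : φ (l.map fun i => s • (P i - algebraMap ℂ A p)).prod = 0 := by
  have h1 : ∀ l : List ι, (l.map fun i => s • (P i - algebraMap ℂ A p)).prod =
      s ^ l.length • (l.map fun i => P i - algebraMap ℂ A p).prod := by
    intro l
    induction l with
    | nil => simp
    | cons a l ih => simp [ih, pow_succ, mul_smul]
  rw [h1, _root_.map_smul, h l hl hc, smul_zero]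

end AlternatingCentered

/-! ### The resolvent of a sum of free idempotents -/

section ResolventRelation

variable {A : Type*} [NormedRing A] [NormedAlgebra ℂ A]

/-- The inverse of `1 + s (P - p)`, for an idempotent `P`. -/
theorem inverse_one_add_smul_idempotent {P : A} (hP : IsIdempotentElem P) {s p : ℂ}
    (h1 : 1 - s * p ≠ 0) (h2 : 1 + s * (1 - p) ≠ 0) :
    (algebraMap ℂ A (1 / (1 - s * p)) - (s / ((1 - s * p) * (1 + s * (1 - p)))) • P) *
      (1 + s • (P - algebraMap ℂ A p)) = 1 := by
  have hPP : P * P = P := hP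
  simp only [Algebra.algebraMap_eq_smul_one, mul_add, sub_mul, mul_sub, smul_sub,
    smul_mul_assoc, mul_smul_comm, one_mul, mul_one, hPP, smul_smul]
  -- Since `P * P = P`, the product stays in the span of `1` and `P`; the two coefficients reduce to
  -- `1` and `0`.
  have e1 : (1 : A) = (1 / (1 - s * p) - 1 / (1 - s * p) * (s * p)) • (1 : A) +
      (1 / (1 - s * p) * s - s / ((1 - s * p) * (1 + s * (1 - p))) -
        (s / ((1 - s * p) * (1 + s * (1 - p)))) * s +
        (s / ((1 - s * p) * (1 + s * (1 - p)))) * (s * p)) • P := by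
    rw [show (1 / (1 - s * p) - 1 / (1 - s * p) * (s * p)) = 1 by field_simp,
      show (1 / (1 - s * p) * s - s / ((1 - s * p) * (1 + s * (1 - p))) -
        (s / ((1 - s * p) * (1 + s * (1 - p)))) * s +
        (s / ((1 - s * p) * (1 + s * (1 - p)))) * (s * p)) = 0 by field_simp; ring]
    simp
  conv_rhs => rw [e1]
  module

variable [CompleteSpace A] {ι : Type*} [Fintype ι] [DecidableEq ι]

/-- The value of the functional `φ` at the resolvent of a sum of free idempotents. -/
theorem AlternatingCentered.map_inverse (φ : A →L[ℂ] ℂ) (h1 : φ 1 = 1) {P : ι → A} {p : ℂ}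
    (hP : ∀ i, IsIdempotentElem (P i)) (hfree : AlternatingCentered φ P p) {s : ℂ}
    (hs : ∀ i, Fintype.card ι * ‖s • (P i - algebraMap ℂ A p)‖ ≤ 1 / 2)
    (hs1 : 1 - s * p ≠ 0) (hs2 : 1 + s * (1 - p) ≠ 0) {N : ℂ} (hN : (Fintype.card ι : ℂ) = N)
    (hN0 : N ≠ 0) {Y : A} (hY : IsUnit Y)
    (hYs : Y = algebraMap ℂ A ((1 + (N - 1) * (s * p)) * (1 + s * (1 - p))) - s • ∑ i, P i) :
    φ (Ring.inverse Y) = 1 / ((1 - s * p) * (1 + s * (1 - p))) := by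
  have hn : (0 : ℝ) < Fintype.card ι := by
    rcases Nat.eq_zero_or_pos (Fintype.card ι) with h | h
    · exact absurd (by rw [← hN, h]; simp) hN0
    · exact_mod_cast h
  obtain ⟨W, hW, hφW⟩ := exists_right_inverse_of_alternating φ
    (fun i => s • (P i - algebraMap ℂ A p))
    (fun i => algebraMap ℂ A (1 / (1 - s * p)) -
      (s / ((1 - s * p) * (1 + s * (1 - p)))) • P i) (ε := 1 / 2 / Fintype.card ι)
    (fun i => by rw [le_div_iff₀' hn]; exact hs i)
    (by rw [mul_div_cancel₀ _ hn.ne']; norm_num) (by positivity)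
    (fun i => inverse_one_add_smul_idempotent (hP i) hs1 hs2)
    (fun l hl hc => hfree.map_smul s l hl hc)
  -- Each inverse is affine in `P i`, so the element inverted by `W` is affine in `∑ i, P i`: it is
  -- a scalar multiple of `Y`.
  have hY2 : ∑ i, (algebraMap ℂ A (1 / (1 - s * p)) -
      (s / ((1 - s * p) * (1 + s * (1 - p)))) • P i) - (Fintype.card ι - 1 : A) =
      (1 / ((1 - s * p) * (1 + s * (1 - p)))) • Y := by
    have hc : (Fintype.card ι : A) = algebraMap ℂ A N := by rw [← hN]; simp
    rw [Finset.sum_sub_distrib, Finset.sum_const, Finset.card_univ, hYs, ← Finset.smul_sum,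
      ← Nat.cast_smul_eq_nsmul ℂ, hN, hc]
    simp only [Algebra.algebraMap_eq_smul_one, smul_sub, smul_smul]
    have e1 : N * (1 / (1 - s * p)) - N + 1 = 1 / ((1 - s * p) * (1 + s * (1 - p))) *
        ((1 + (N - 1) * (s * p)) * (1 + s * (1 - p))) := by field_simp; ring
    have e2 : 1 / ((1 - s * p) * (1 + s * (1 - p))) * s =
      s / ((1 - s * p) * (1 + s * (1 - p))) := by ring
    rw [← e1, e2]
    module
  rw [hY2, smul_mul_assoc, ← mul_smul_comm] at hW
  have h3 : Ring.inverse Y = (1 / ((1 - s * p) * (1 + s * (1 - p)))) • W := by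
    rw [← one_mul (_ • W), ← Ring.inverse_mul_cancel _ hY, mul_assoc, hW, mul_one]
  rw [h3, _root_.map_smul, hφW, h1, smul_eq_mul, mul_one]

/-- The algebraic equation satisfied by the (rescaled) resolvent of a sum of free idempotents. -/
theorem AlternatingCentered.resolvent_relation (φ : A →L[ℂ] ℂ) (h1 : φ 1 = 1) {P : ι → A} {p : ℂ}
    (hP : ∀ i, IsIdempotentElem (P i)) (hfree : AlternatingCentered φ P p) {N : ℂ}
    (hN : (Fintype.card ι : ℂ) = N) (hN0 : N ≠ 0) {T : A} (hT : T = 1 - (1 / N) • ∑ i, P i)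
    (hT1 : ‖T‖ ≤ 1) (h : ℂ → ℂ) (hh : ∀ x, h x = (1 - x) * φ (Ring.inverse (1 - x • T)))
    {x : ℂ} (hx : ‖x‖ < 1) :
    x * h x * (h x - 1 + N * p) = (1 - x) * (h x + N - 1) * (1 - h x) := by
  have hunit : ∀ x : ℂ, ‖x‖ < 1 → IsUnit (1 - x • T) := fun x hx =>
    isUnit_one_sub_of_norm_lt_one <| by
      rw [norm_smul]
      exact (mul_le_of_le_one_right (norm_nonneg _) hT1).trans_lt hx
  have hA : AnalyticOnNhd ℂ h (Metric.ball 0 1) := by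
    intro x hx
    rw [mem_ball_zero_iff] at hx
    obtain ⟨u, hu⟩ := hunit x hx
    have e1 : h = fun x => (1 - x) * φ (Ring.inverse (1 - x • T)) := funext hh
    rw [e1]
    refine (analyticAt_const.sub analyticAt_id).mul ?_
    refine (φ.analyticAt _).comp (AnalyticAt.fun_comp (g := Ring.inverse) ?_ ?_)
    · rw [← hu]; exact analyticAt_inverse u
    · exact analyticAt_const.sub (analyticAt_id.smul analyticAt_const)
  set f : ℂ → ℂ := fun x =>
    x * h x * (h x - 1 + N * p) - (1 - x) * (h x + N - 1) * (1 - h x) with hf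
  have hfA : AnalyticOnNhd ℂ f (Metric.ball 0 1) := by
    intro x hx
    have h2 := hA x hx
    have h3 : AnalyticAt ℂ (fun x : ℂ => x) x := analyticAt_id
    have hc : ∀ c : ℂ, AnalyticAt ℂ (fun _ : ℂ => c) x := fun c => analyticAt_const
    exact ((h3.mul h2).mul ((h2.sub (hc 1)).add (hc _))).sub
      ((((hc 1).sub h3).mul ((h2.add (hc N)).sub (hc 1))).mul ((hc 1).sub h2))
  -- Identity theorem: `f` is analytic on the unit disc, so zeros accumulating at `0` suffice.
  suffices hfreq : ∃ᶠ x in 𝓝[≠] (0 : ℂ), f x = 0 from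
    sub_eq_zero.1 (hfA.eqOn_zero_of_preconnected_of_frequently_eq_zero
      (convex_ball 0 1).isPreconnected (Metric.mem_ball_self one_pos) hfreq
      (mem_ball_zero_iff.2 hx))
  -- the rational parametrization near `0`
  set D : ℂ → ℂ := fun s => N * s - (1 + (N - 1) * (s * p)) * (1 + s * (1 - p)) with hD
  have hDc : Continuous D := by fun_prop
  have hD0 : D 0 ≠ 0 := by simp [hD]
  have hxc : ContinuousAt (fun s => N * s / D s) 0 :=
    ContinuousAt.div (by fun_prop) hDc.continuousAt hD0
  have ev : ∀ {g : ℂ → ℂ}, Continuous g → g 0 ≠ 0 → ∀ᶠ s in 𝓝[≠] (0 : ℂ), g s ≠ 0 :=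
    fun hg h0 => eventually_nhdsWithin_of_eventually_nhds (hg.continuousAt.eventually_ne h0)
  have evs : ∀ᶠ s in 𝓝[≠] (0 : ℂ),
      ∀ i, Fintype.card ι * ‖s • (P i - algebraMap ℂ A p)‖ ≤ 1 / 2 := by
    refine eventually_all.2 fun i => eventually_nhdsWithin_of_eventually_nhds ?_
    have hc : ContinuousAt (fun s : ℂ => Fintype.card ι * ‖s • (P i - algebraMap ℂ A p)‖) 0 := by
      fun_prop
    refine (hc.eventually_lt (continuousAt_const (y := (1 / 2 : ℝ))) ?_).mono fun s hs => hs.le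
    simp
  have evx : ∀ᶠ s in 𝓝[≠] (0 : ℂ), ‖N * s / D s‖ < 1 :=
    eventually_nhdsWithin_of_eventually_nhds
      (hxc.norm.eventually_lt (continuousAt_const (y := (1 : ℝ))) (by simp))
  have evD := ev hDc hD0
  have key : ∀ᶠ s in 𝓝[≠] (0 : ℂ), f (N * s / D s) = 0 := by
    filter_upwards [evs, evx, evD, ev (g := fun s => 1 - s * p) (by fun_prop) (by simp),
      ev (g := fun s => 1 + s * (1 - p)) (by fun_prop) (by simp)] with s hs hsx hsD hs1 hs2
    set Y : A := algebraMap ℂ A ((1 + (N - 1) * (s * p)) * (1 + s * (1 - p))) - s • ∑ i, P i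
      with hY
    -- `D` is chosen so that at `x = N * s / D s` the element `1 - x • T` is proportional to `Y`,
    -- whose inverse has a known image under `φ`.
    have hYT : (1 - (N * s / D s) • T) = (-1 / D s) • Y := by
      rw [hT, hY]
      simp only [Algebra.algebraMap_eq_smul_one, smul_sub, smul_smul]
      rw [show N * s / D s * (1 / N) = s / D s by field_simp,
        show -1 / D s * ((1 + (N - 1) * (s * p)) * (1 + s * (1 - p))) = 1 - N * s / D s by
          field_simp; simp only [hD]; ring, show -1 / D s * s = - (s / D s) by ring]
      module
    have hu := hunit _ hsx
    have hYu : IsUnit Y := by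
      have : Y = (algebraMap ℂ A (-D s)) * (1 - (N * s / D s) • T) := by
        rw [hYT, ← Algebra.smul_def, smul_smul,
          show -D s * (-1 / D s) = 1 by field_simp, one_smul]
      rw [this]
      exact ((isUnit_iff_ne_zero.2 (neg_ne_zero.2 hsD)).map (algebraMap ℂ A)).mul hu
    have hinv : Ring.inverse (1 - (N * s / D s) • T) = (-D s) • Ring.inverse Y := by
      have e1 : (1 - (N * s / D s) • T) * ((-D s) • Ring.inverse Y) = 1 := by
        rw [hYT, smul_mul_smul_comm, Ring.mul_inverse_cancel _ hYu,
          show -1 / D s * (-D s) = 1 by field_simp, one_smul]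
      exact (Ring.inverse_mul_eq_iff_eq_mul _ _ _ hu).2 e1.symm ▸ (mul_one _).symm
    have hhx : h (N * s / D s) = (1 + (N - 1) * (s * p)) / (1 - s * p) := by
      rw [hh, hinv, _root_.map_smul,
        AlternatingCentered.map_inverse φ h1 hP hfree hs hs1 hs2 hN hN0 hYu hY, smul_eq_mul]
      field_simp
      simp only [hD]; ring
    simp only [hf]
    rw [hhx]
    field_simp
    simp only [hD]
    ring
  -- The zeros found must differ from `0` in order to accumulate there.
  have hne : ∀ᶠ s in 𝓝[≠] (0 : ℂ), N * s / D s ∈ ({0}ᶜ : Set ℂ) := by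
    filter_upwards [evD, self_mem_nhdsWithin] with s hsD hs
    exact div_ne_zero (mul_ne_zero hN0 hs) hsD
  have htend : Tendsto (fun s => N * s / D s) (𝓝[≠] 0) (𝓝[≠] 0) := by
    refine tendsto_nhdsWithin_iff.2 ⟨?_, hne⟩
    have := hxc.tendsto.mono_left (nhdsWithin_le_nhds (s := {0}ᶜ))
    simpa using this
  exact htend.frequently key.frequently

end ResolventRelation

/-! ### Positivity of strong limits -/

section StrongLimit

variable {H : Type u} [NormedAddCommGroup H] [InnerProductSpace ℂ H]

theorem nonneg_of_tendsto_apply {A : ℕ → H →L[ℂ] H} {B : H →L[ℂ] H} (hA : ∀ k, 0 ≤ A k)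
    (h : ∀ v, Tendsto (fun k => A k v) atTop (𝓝 (B v))) : 0 ≤ B := by
  rw [ContinuousLinearMap.nonneg_iff_isPositive, ContinuousLinearMap.isPositive_iff_complex]
  intro v
  have h1 : Tendsto (fun k => inner ℂ (A k v) v) atTop (𝓝 (inner ℂ (B v) v)) :=
    (h v).inner tendsto_const_nhds
  have h2 : (0 : ℂ) ≤ inner ℂ (B v) v := ge_of_tendsto' h1 fun k =>
    ((ContinuousLinearMap.nonneg_iff_isPositive _).1 (hA k)).inner_nonneg_left v
  rw [Complex.le_def] at h2
  exact ⟨Complex.ext rfl (by simpa using h2.2), by simpa using h2.1⟩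

end StrongLimit

/-! ### Positivity, continuity and normality of the trace -/

section TracialState

variable {H : Type u} [NormedAddCommGroup H] [InnerProductSpace ℂ H] [CompleteSpace H]
  {M : VonNeumannAlgebra H} {τ : M.toStarSubalgebra →ₗ[ℂ] ℂ}

theorem VonNeumannAlgebra.cfc_mem {X : H →L[ℂ] H} (hX : X ∈ M) (f : ℝ → ℝ) : cfc f X ∈ M := by
  rw [← VonNeumannAlgebra.commutant_commutant M, VonNeumannAlgebra.mem_commutant_iff]
  intro y hy
  have hXy : Commute X y := VonNeumannAlgebra.mem_commutant_iff.1 hy X hX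
  exact (hXy.cfc_real f).eq.symm

theorem VonNeumannAlgebra.isClosed_toStarSubalgebra (M : VonNeumannAlgebra H) :
    IsClosed (M.toStarSubalgebra : Set (H →L[ℂ] H)) := by
  rw [VonNeumannAlgebra.coe_toStarSubalgebra, ← VonNeumannAlgebra.centralizer_centralizer M]
  exact Set.isClosed_centralizer _

instance VonNeumannAlgebra.completeSpace_toStarSubalgebra (M : VonNeumannAlgebra H) :
    CompleteSpace M.toStarSubalgebra :=
  M.isClosed_toStarSubalgebra.completeSpace_coe

/-- The square root of `a` is a function of `a`, hence stays in the algebra, and `a` becomes `star y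
* y`. The order used is that of the operators on `H`. -/
theorem IsFaithfulNormalTracialState.map_nonneg (hτ : IsFaithfulNormalTracialState τ)
    {a : M.toStarSubalgebra} (ha : (0 : H →L[ℂ] H) ≤ a) : 0 ≤ τ a := by
  have hsa : IsSelfAdjoint (a : H →L[ℂ] H) := ha.isSelfAdjoint
  set y : M.toStarSubalgebra := ⟨cfc Real.sqrt (a : H →L[ℂ] H), VonNeumannAlgebra.cfc_mem a.2 _⟩
  have hy : star y * y = a := by
    refine Subtype.ext ?_
    have h1 : star (cfc Real.sqrt (a : H →L[ℂ] H)) = cfc Real.sqrt (a : H →L[ℂ] H) :=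
      (cfc_predicate Real.sqrt (a : H →L[ℂ] H) : IsSelfAdjoint _)
    have h2 : cfc Real.sqrt (a : H →L[ℂ] H) * cfc Real.sqrt (a : H →L[ℂ] H) = a := by
      rw [← cfc_mul _ _ _ (by fun_prop) (by fun_prop)]
      conv_rhs => rw [← cfc_id ℝ (a : H →L[ℂ] H)]
      exact cfc_congr fun t ht => Real.mul_self_sqrt (spectrum_nonneg_of_nonneg ha ht)
    calc ((star y * y : M.toStarSubalgebra) : H →L[ℂ] H)
        = star (cfc Real.sqrt (a : H →L[ℂ] H)) * cfc Real.sqrt (a : H →L[ℂ] H) := rfl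
      _ = a := by rw [h1, h2]
  rw [← hy]
  exact hτ.nonneg y

theorem IsFaithfulNormalTracialState.mono (hτ : IsFaithfulNormalTracialState τ)
    {a b : M.toStarSubalgebra} (hab : (a : H →L[ℂ] H) ≤ b) : τ a ≤ τ b := by
  rw [← sub_nonneg, ← map_sub]
  exact hτ.map_nonneg (a := b - a) (sub_nonneg.2 hab)

theorem IsFaithfulNormalTracialState.norm_map_le_of_isSelfAdjoint
    (hτ : IsFaithfulNormalTracialState τ) {a : M.toStarSubalgebra}
    (ha : IsSelfAdjoint (a : H →L[ℂ] H)) : ‖τ a‖ ≤ ‖a‖ := by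
  have hc : ∀ r : ℝ, τ ((r : ℂ) • 1) = r := fun r => by rw [map_smul, hτ.map_one]; simp
  have hcoe : ∀ r : ℝ, (((r : ℂ) • 1 : M.toStarSubalgebra) : H →L[ℂ] H) =
      algebraMap ℝ (H →L[ℂ] H) r := fun r => by rw [Algebra.algebraMap_eq_smul_one]; rfl
  have h1 : τ a ≤ (‖a‖ : ℝ) := by
    rw [← hc]
    refine hτ.mono ?_
    rw [hcoe]
    exact ha.le_algebraMap_norm_self
  have h2 : ((-‖a‖ : ℝ) : ℂ) ≤ τ a := by
    rw [← hc]
    refine hτ.mono ?_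
    rw [hcoe, map_neg]
    exact ha.neg_algebraMap_norm_le_self
  rw [Complex.le_def] at h1 h2
  have h3 : τ a = ((τ a).re : ℂ) := Complex.ext rfl (by simpa using h1.2)
  rw [h3, Complex.norm_real, Real.norm_eq_abs, abs_le]
  exact ⟨by simpa using h2.1, by simpa using h1.1⟩

/-- The constant `2` comes from treating real and imaginary parts separately; only continuity
matters. -/
theorem IsFaithfulNormalTracialState.norm_map_le (hτ : IsFaithfulNormalTracialState τ)
    (a : M.toStarSubalgebra) : ‖τ a‖ ≤ 2 * ‖a‖ := by
  have hstar : ‖star a‖ = ‖a‖ := norm_star (a : H →L[ℂ] H)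
  set b : M.toStarSubalgebra := (1 / 2 : ℂ) • (a + star a) with hb
  set c : M.toStarSubalgebra := (-Complex.I / 2) • (a - star a) with hc
  have hbs : IsSelfAdjoint (b : H →L[ℂ] H) := by
    refine congr_arg Subtype.val (?_ : star b = b)
    simp [hb, add_comm]
  have hcs : IsSelfAdjoint (c : H →L[ℂ] H) := by
    refine congr_arg Subtype.val (?_ : star c = c)
    rw [hc, star_smul, star_sub, star_star, ← neg_sub a, smul_neg, ← neg_smul]
    simp [neg_div]
  have ha : a = b + Complex.I • c := by
    rw [hb, hc, smul_smul, show Complex.I * (-Complex.I / 2) = 1 / 2 by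
      rw [mul_div_assoc', mul_neg, Complex.I_mul_I, neg_neg]]
    module
  have hb1 : ‖b‖ ≤ ‖a‖ := by
    rw [hb, norm_smul, show ‖(1 / 2 : ℂ)‖ = 1 / 2 by norm_num]
    have := norm_add_le a (star a)
    linarith
  have hc1 : ‖c‖ ≤ ‖a‖ := by
    rw [hc, norm_smul, show ‖(-Complex.I / 2 : ℂ)‖ = 1 / 2 by simp]
    have := norm_sub_le a (star a)
    linarith
  have h1 := hτ.norm_map_le_of_isSelfAdjoint hbs
  have h2 := hτ.norm_map_le_of_isSelfAdjoint hcs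
  have h3 := norm_add_le (τ b) (Complex.I • τ c)
  rw [norm_smul, Complex.norm_I, one_mul, ← map_smul, ← map_add, ← ha] at h3
  linarith

/-- A tracial state as a continuous linear functional. -/
noncomputable def IsFaithfulNormalTracialState.toCLM (hτ : IsFaithfulNormalTracialState τ) :
    M.toStarSubalgebra →L[ℂ] ℂ :=
  τ.mkContinuous 2 hτ.norm_map_le

@[simp]
theorem IsFaithfulNormalTracialState.toCLM_apply (hτ : IsFaithfulNormalTracialState τ)
    (a : M.toStarSubalgebra) : hτ.toCLM a = τ a := rfl

/-- Normality of a tracial state for increasing sequences that converge strongly. -/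
theorem IsFaithfulNormalTracialState.tendsto_of_monotone (hτ : IsFaithfulNormalTracialState τ)
    {A : ℕ → M.toStarSubalgebra} {B : M.toStarSubalgebra}
    (hsa : ∀ k, IsSelfAdjoint (A k)) (hmono : Monotone A)
    (h : ∀ v, Tendsto (fun k => (A k : H →L[ℂ] H) v) atTop (𝓝 ((B : H →L[ℂ] H) v))) :
    Tendsto (fun k => (τ (A k)).re) atTop (𝓝 (τ B).re) := by
  -- Normality speaks of suprema, so the strong limit must be recognized as one; both halves follow
  -- because positivity survives strong limits.
  have hlub : IsLUB (Set.range A) B := by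
    constructor
    · rintro _ ⟨k, rfl⟩
      refine sub_nonneg.1 (nonneg_of_tendsto_apply
        (A := fun j => (A (k + j) - A k : H →L[ℂ] H)) (fun j => ?_) fun v => ?_)
      · exact sub_nonneg.2 (hmono (Nat.le_add_right k j))
      · have := (h v).comp (tendsto_add_atTop_nat k)
        simp only [add_comm k]
        exact this.sub_const _
    · intro C hC
      refine sub_nonneg.1 (nonneg_of_tendsto_apply
        (A := fun j => (C - A j : H →L[ℂ] H)) (fun j => ?_) fun v => ?_)
      · exact sub_nonneg.2 (hC ⟨j, rfl⟩)
      · exact tendsto_const_nhds.sub (h v)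
  have h1 := hτ.normal (Set.range A) B (Set.range_nonempty A) (directedOn_range.2 hmono.directed_le)
    (by rintro _ ⟨k, rfl⟩; exact hsa k) hlub
  rw [← Set.range_comp] at h1
  refine tendsto_atTop_isLUB (fun i j hij => ?_) h1
  exact (Complex.le_def.1 (hτ.mono (hmono hij))).1

end TracialState

/-! ### Abel means of a positive contraction -/

section Resolvent

variable {H : Type u} [NormedAddCommGroup H] [InnerProductSpace ℂ H] [CompleteSpace H]

/-- The function `t ↦ δ / (1 - (1 - δ) t)`. -/
noncomputable def resolventFun (δ t : ℝ) : ℝ := δ / (1 - (1 - δ) * t)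

theorem resolventFun_denom_ge {δ t : ℝ} (hδ : δ ≤ 1) (ht1 : t ≤ 1) : δ ≤ 1 - (1 - δ) * t := by
  nlinarith

variable {T : H →L[ℂ] H}

theorem mem_Icc_of_mem_spectrum (h0 : 0 ≤ T) (h1 : T ≤ 1) {t : ℝ} (ht : t ∈ spectrum ℝ T) :
    0 ≤ t ∧ t ≤ 1 :=
  ⟨spectrum_nonneg_of_nonneg h0 ht, (le_abs_self t).trans ((abs_le_of_mem_spectrum T ht).trans
    ((CStarAlgebra.norm_le_one_iff_of_nonneg T h0).2 h1))⟩

theorem continuousOn_resolventFun (h0 : 0 ≤ T) (h1 : T ≤ 1) {δ : ℝ} (hδ0 : 0 < δ) (hδ : δ ≤ 1) :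
    ContinuousOn (resolventFun δ) (spectrum ℝ T) := by
  refine ContinuousOn.div (by fun_prop) (by fun_prop) fun t ht => ?_
  exact (hδ0.trans_le (resolventFun_denom_ge hδ (mem_Icc_of_mem_spectrum h0 h1 ht).2)).ne'

/-- This links the functional calculus, convenient for order and norm estimates, with the algebraic
inverse of `1 - x • T` at `x = 1 - δ`. -/
theorem cfc_resolventFun_mul (h0 : 0 ≤ T) (h1 : T ≤ 1) {δ : ℝ} (hδ0 : 0 < δ) (hδ : δ ≤ 1) :
    cfc (resolventFun δ) T * (1 - (1 - δ) • T) = δ • 1 ∧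
      (1 - (1 - δ) • T) * cfc (resolventFun δ) T = δ • 1 := by
  have hsa : IsSelfAdjoint T := h0.isSelfAdjoint
  have hc := continuousOn_resolventFun h0 h1 hδ0 hδ
  have e1 : cfc (fun t : ℝ => 1 - (1 - δ) * t) T = 1 - (1 - δ) • T := by
    rw [cfc_sub (fun _ => (1 : ℝ)) (fun t => (1 - δ) * t) T, cfc_const_one ℝ T,
      cfc_const_mul_id (1 - δ) T]
  have e2 : cfc (resolventFun δ) T * cfc (fun t : ℝ => 1 - (1 - δ) * t) T = δ • 1 := by
    rw [← cfc_mul _ _ T hc (by fun_prop), ← Algebra.algebraMap_eq_smul_one, ← cfc_const δ T]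
    refine cfc_congr fun t ht => ?_
    have := hδ0.trans_le (resolventFun_denom_ge hδ (mem_Icc_of_mem_spectrum h0 h1 ht).2)
    simp only [resolventFun]
    rw [div_mul_cancel₀ _ this.ne']
  rw [← e1]
  exact ⟨e2, by rw [(cfc_commute_cfc _ _ T).eq, e2]⟩

/-- The denominator is at most `1` on the spectrum. The bound later makes the traces of the Abel
means strictly positive, which permits division by them. -/
theorem le_cfc_resolventFun (h0 : 0 ≤ T) (h1 : T ≤ 1) {δ : ℝ} (hδ0 : 0 < δ) (hδ : δ ≤ 1) :
    δ • 1 ≤ cfc (resolventFun δ) T := by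
  have hsa : IsSelfAdjoint T := h0.isSelfAdjoint
  rw [← Algebra.algebraMap_eq_smul_one, ← cfc_const δ T]
  refine cfc_mono (fun t ht => ?_) (by fun_prop) (continuousOn_resolventFun h0 h1 hδ0 hδ)
  obtain ⟨ht0, ht1⟩ := mem_Icc_of_mem_spectrum h0 h1 ht
  rw [resolventFun, le_div_iff₀ (hδ0.trans_le (resolventFun_denom_ge hδ ht1))]
  nlinarith [mul_nonneg (sub_nonneg.2 hδ) ht0]

/-- For `t ≤ 1` the quotient increases with `δ`. This monotonicity is what lets normality of the
trace be used as `δ` tends to `0`. -/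
theorem cfc_resolventFun_mono (h0 : 0 ≤ T) (h1 : T ≤ 1) {δ ε : ℝ} (hδ0 : 0 < δ) (hδε : δ ≤ ε)
    (hε : ε ≤ 1) : cfc (resolventFun δ) T ≤ cfc (resolventFun ε) T := by
  refine cfc_mono (fun t ht => ?_) (continuousOn_resolventFun h0 h1 hδ0 (hδε.trans hε))
    (continuousOn_resolventFun h0 h1 (hδ0.trans_le hδε) hε)
  obtain ⟨ht0, ht1⟩ := mem_Icc_of_mem_spectrum h0 h1 ht
  rw [resolventFun, resolventFun,
    div_le_div_iff₀ (hδ0.trans_le (resolventFun_denom_ge (hδε.trans hε) ht1))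
      ((hδ0.trans_le hδε).trans_le (resolventFun_denom_ge hε ht1))]
  nlinarith [mul_nonneg (sub_nonneg.2 hδε) (sub_nonneg.2 ht1)]

theorem cfc_resolventFun_le_one (h0 : 0 ≤ T) (h1 : T ≤ 1) {δ : ℝ} (hδ0 : 0 < δ) (hδ : δ ≤ 1) :
    cfc (resolventFun δ) T ≤ 1 := by
  refine (cfc_resolventFun_mono h0 h1 hδ0 hδ le_rfl).trans ?_
  have hsa : IsSelfAdjoint T := h0.isSelfAdjoint
  have : resolventFun 1 = fun _ => 1 := by funext t; simp [resolventFun]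
  rw [this, cfc_const_one ℝ T]

theorem norm_cfc_resolventFun_mul_le (h0 : 0 ≤ T) (h1 : T ≤ 1) {δ : ℝ} (hδ0 : 0 < δ)
    (hδ : δ ≤ 1) : ‖cfc (resolventFun δ) T * (1 - T)‖ ≤ δ := by
  have hsa : IsSelfAdjoint T := h0.isSelfAdjoint
  have e1 : cfc (fun t : ℝ => 1 - t) T = 1 - T := by
    rw [cfc_sub (fun _ => (1 : ℝ)) (fun t => t) T, cfc_const_one ℝ T, cfc_id' ℝ T]
  rw [← e1, ← cfc_mul _ _ T (continuousOn_resolventFun h0 h1 hδ0 hδ) (by fun_prop)]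
  refine norm_cfc_le hδ0.le fun t ht => ?_
  obtain ⟨ht0, ht1⟩ := mem_Icc_of_mem_spectrum h0 h1 ht
  have hd := hδ0.trans_le (resolventFun_denom_ge hδ ht1)
  rw [resolventFun, Real.norm_eq_abs, abs_of_nonneg (mul_nonneg (div_nonneg hδ0.le hd.le)
    (sub_nonneg.2 ht1)), div_mul_eq_mul_div, div_le_iff₀ hd]
  nlinarith [mul_nonneg hδ0.le ht0]

/-- The mean ergodic theorem for Abel means of a positive contraction. -/
theorem tendsto_cfc_resolventFun (h0 : 0 ≤ T) (h1 : T ≤ 1) {δ : ℕ → ℝ} (hδ0 : ∀ k, 0 < δ k)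
    (hδ : ∀ k, δ k ≤ 1) (hlim : Tendsto δ atTop (𝓝 0)) {K : H →L[ℂ] H} (hK : IsStarProjection K)
    (hKr : ∀ v, v ∈ K.range ↔ T v = v) (v : H) :
    Tendsto (fun k => cfc (resolventFun (δ k)) T v) atTop (𝓝 (K v)) := by
  have hsa : ContinuousLinearMap.adjoint T = T := h0.isSelfAdjoint
  have hfix : ∀ k, cfc (resolventFun (δ k)) T (K v) = K v := by
    intro k
    have e1 : T (K v) = K v := (hKr _).1 ⟨v, rfl⟩
    have e2 : cfc (resolventFun (δ k)) T ((1 - (1 - δ k) • T) (K v)) = δ k • K v :=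
      congr($((cfc_resolventFun_mul h0 h1 (hδ0 k) (hδ k)).1) (K v))
    have e3 : (1 - (1 - δ k) • T) (K v) = δ k • K v := by
      have : (1 - (1 - δ k) • T) (K v) = K v - (1 - δ k) • T (K v) := rfl
      rw [this, e1]; module
    rw [e3, ContinuousLinearMap.map_smul_of_tower] at e2
    exact smul_right_injective H (hδ0 k).ne' e2
  have hnorm : ∀ k, ‖cfc (resolventFun (δ k)) T‖ ≤ 1 := fun k =>
    (CStarAlgebra.norm_le_one_iff_of_nonneg _ (le_trans (smul_nonneg (hδ0 k).le zero_le_one)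
      (le_cfc_resolventFun h0 h1 (hδ0 k) (hδ k)))).2 (cfc_resolventFun_le_one h0 h1 (hδ0 k) (hδ k))
  -- The orthogonal complement of the range of the selfadjoint `1 - T` is its kernel, which is the
  -- range of `K`.
  have hw : v - K v ∈ (1 - T).range.topologicalClosure := by
    have hsa' : ContinuousLinearMap.adjoint (1 - T) = 1 - T := by
      have : IsSelfAdjoint (1 - T) := (IsSelfAdjoint.one _).sub h0.isSelfAdjoint
      exact this
    rw [← Submodule.orthogonal_orthogonal_eq_closure, ContinuousLinearMap.orthogonal_range, hsa',
      Submodule.mem_orthogonal]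
    intro u hu
    have hu' : T u = u := by
      have : u - T u = 0 := hu
      exact (sub_eq_zero.1 this).symm
    obtain ⟨w, rfl⟩ := (hKr u).2 hu'
    have hKsa : ContinuousLinearMap.adjoint K = K := hK.isSelfAdjoint
    have hKK : K (K v) = K v := congr($(hK.isIdempotentElem.eq) v)
    show inner ℂ (K w) (v - K v) = 0
    nth_rw 1 [← hKsa]
    rw [ContinuousLinearMap.adjoint_inner_left, map_sub, hKK, sub_self, inner_zero_right]
  -- On the range of `1 - T` the Abel means are `O(δ k)`; the uniform bound `hnorm` extends
  -- convergence to the closure.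
  have hzero : Tendsto (fun k => cfc (resolventFun (δ k)) T (v - K v)) atTop (𝓝 0) := by
    rw [Metric.tendsto_atTop]
    intro ε hε
    obtain ⟨_, ⟨u, rfl⟩, hu⟩ := Metric.mem_closure_iff.1 hw (ε / 2) (by positivity)
    have hu2 : Tendsto (fun k => δ k * ‖u‖) atTop (𝓝 0) := by simpa using hlim.mul_const ‖u‖
    obtain ⟨k₀, hk₀⟩ :=
      (hu2.eventually_lt_const (show (0 : ℝ) < ε / 2 by positivity)).exists_forall_of_atTop
    refine ⟨k₀, fun k hk => ?_⟩
    rw [dist_zero_right]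
    have e1 : cfc (resolventFun (δ k)) T (v - K v) =
        cfc (resolventFun (δ k)) T (v - K v - (1 - T) u) +
          (cfc (resolventFun (δ k)) T * (1 - T)) u := by
      rw [map_sub _ (v - K v)]
      exact (sub_add_cancel _ _).symm
    rw [dist_eq_norm] at hu
    calc ‖cfc (resolventFun (δ k)) T (v - K v)‖
        ≤ 1 * ‖v - K v - (1 - T) u‖ + δ k * ‖u‖ := by
          rw [e1]
          refine (norm_add_le _ _).trans (add_le_add ?_ ?_)
          · exact (ContinuousLinearMap.le_opNorm _ _).trans (by gcongr; exact hnorm k)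
          · refine (ContinuousLinearMap.le_opNorm _ _).trans ?_
            gcongr
            exact norm_cfc_resolventFun_mul_le h0 h1 (hδ0 k) (hδ k)
      _ < ε := by
          have := hk₀ k hk
          have hu : ‖v - K v - (1 - T) u‖ < ε / 2 := hu
          linarith
  have hsum := hzero.add_const (K v)
  rw [zero_add] at hsum
  refine hsum.congr fun k => ?_
  rw [map_sub, hfix, sub_add_cancel]

end Resolvent

/-! ### The trace of the common kernel of free projections -/

section KernelTrace

/-- The admissible limit of the solutions of the resolvent equation at the edge `δ = 0`. -/
theorem eq_max_of_resolvent_relation {a δ : ℕ → ℝ} {L N p : ℝ} (hδ0 : ∀ k, 0 < δ k)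
    (hδ : Tendsto δ atTop (𝓝 0)) (hδ1 : ∀ k, δ k < 1) (hN : 1 ≤ N) (ha : Tendsto a atTop (𝓝 L))
    (ha1 : ∀ k, a k ≤ 1) (haδ : ∀ k, δ k ≤ a k)
    (hrel : ∀ k, (1 - δ k) * a k * (a k - 1 + N * p) = δ k * (a k + N - 1) * (1 - a k)) :
    L = max 0 (1 - N * p) := by
  have hL : L * (L - 1 + N * p) = 0 := by
    have e1 : Tendsto (fun k => (1 - δ k) * a k * (a k - 1 + N * p)) atTop
        (𝓝 ((1 - 0) * L * (L - 1 + N * p))) :=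
      ((tendsto_const_nhds.sub hδ).mul ha).mul ((ha.sub_const 1).add_const _)
    have e2 : Tendsto (fun k => δ k * (a k + N - 1) * (1 - a k)) atTop
        (𝓝 (0 * (L + N - 1) * (1 - L))) :=
      (hδ.mul ((ha.add_const N).sub_const 1)).mul (tendsto_const_nhds.sub ha)
    have := tendsto_nhds_unique (e1.congr hrel) e2
    linarith
  have hL0 : 0 ≤ L := ge_of_tendsto' ha fun k => (hδ0 k).le.trans (haδ k)
  -- The right side of the relation is nonnegative and `(1 - δ k) * a k` is positive, so `a k - 1 +
  -- N * p` is nonnegative for each `k`. This excludes the root `0` when `1 - N * p > 0`.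
  have hL1 : 1 - N * p ≤ L := by
    refine ge_of_tendsto' ha fun k => ?_
    have h1 : 0 < (1 - δ k) * a k :=
      mul_pos (sub_pos.2 (hδ1 k)) ((hδ0 k).trans_le (haδ k))
    have h2 : 0 ≤ δ k * (a k + N - 1) * (1 - a k) :=
      mul_nonneg (mul_nonneg (hδ0 k).le (by linarith [hδ0 k, haδ k])) (sub_nonneg.2 (ha1 k))
    rw [← hrel] at h2
    have := nonneg_of_mul_nonneg_right h2 h1
    linarith
  rcases mul_eq_zero.1 hL with h | h
  · rw [max_eq_left (by linarith), h]
  · rw [max_eq_right (by linarith)]; linarith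

variable {H : Type u} [NormedAddCommGroup H] [InnerProductSpace ℂ H] [CompleteSpace H]

/-- The inner product of `v` with the image of `v` under the sum is the sum of the squares `‖P i v‖
^ 2`, so no cancellation can occur. -/
theorem sum_apply_eq_zero_iff {ι : Type*} (s : Finset ι) {P : ι → H →L[ℂ] H}
    (hP : ∀ i, IsStarProjection (P i)) (v : H) :
    (∑ i ∈ s, P i) v = 0 ↔ ∀ i ∈ s, P i v = 0 := by
  constructor
  · intro hv
    have key : ∀ i, (inner ℂ v (P i v)).re = ‖P i v‖ ^ 2 := fun i => by
      have h1 : P i (P i v) = P i v := congr($((hP i).isIdempotentElem.eq) v)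
      have h2 : ContinuousLinearMap.adjoint (P i) = P i := (hP i).isSelfAdjoint
      have h3 : inner ℂ v (P i v) = inner ℂ (P i v) (P i v) := by
        conv_lhs => rw [← h1, ← ContinuousLinearMap.adjoint_inner_left, h2]
      rw [h3, inner_self_eq_norm_sq_to_K]
      norm_cast
    have h0 : ∑ i ∈ s, ‖P i v‖ ^ 2 = 0 := by
      have h1 : (inner ℂ v ((∑ i ∈ s, P i) v)).re = ∑ i ∈ s, ‖P i v‖ ^ 2 := by
        rw [_root_.sum_apply, inner_sum, Complex.re_sum]
        exact Finset.sum_congr rfl fun i _ => key i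
      rw [← h1, hv, inner_zero_right, Complex.zero_re]
    intro i hi
    have := (Finset.sum_eq_zero_iff_of_nonneg fun i _ => sq_nonneg ‖P i v‖).1 h0 i hi
    simpa using this
  · intro h
    rw [_root_.sum_apply]
    exact Finset.sum_eq_zero h

variable {M : VonNeumannAlgebra H} {τ : M.toStarSubalgebra →ₗ[ℂ] ℂ}

/-- The trace of the projection onto the intersection of the kernels of free projections. -/
theorem IsFaithfulNormalTracialState.trace_iInf_ker (hτ : IsFaithfulNormalTracialState τ)
    {ι : Type*} [Fintype ι] [DecidableEq ι] [Nonempty ι] {P : ι → M.toStarSubalgebra}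
    (hP : ∀ i, IsStarProjection (P i : H →L[ℂ] H)) {p : ℝ}
    (hfree : AlternatingCentered hτ.toCLM P (p : ℂ)) {K : M.toStarSubalgebra}
    (hK : IsStarProjection (K : H →L[ℂ] H))
    (hKr : ∀ v, v ∈ (K : H →L[ℂ] H).range ↔ ∀ i, (P i : H →L[ℂ] H) v = 0) :
    (τ K).re = max 0 (1 - Fintype.card ι * p) := by
  set N : ℝ := (Fintype.card ι : ℝ) with hNdef
  have hN1 : 1 ≤ N := by
    rw [hNdef, Nat.one_le_cast]
    exact Fintype.card_pos
  have hN : 0 < N := by linarith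
  set T : M.toStarSubalgebra := 1 - (1 / (N : ℂ)) • ∑ i, P i with hT
  have hTcoe : (T : H →L[ℂ] H) = 1 - (1 / N) • ∑ i, (P i : H →L[ℂ] H) := by
    have h1 : (T : H →L[ℂ] H) = 1 - (1 / (N : ℂ)) • ((∑ i, P i : M.toStarSubalgebra) : H →L[ℂ] H) :=
      rfl
    rw [h1, AddSubmonoidClass.coe_finsetSum, show (1 / (N : ℂ)) = ((1 / N : ℝ) : ℂ) by push_cast; rfl]
    rfl
  have hT1 : (T : H →L[ℂ] H) ≤ 1 := by
    rw [hTcoe, sub_le_self_iff]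
    exact smul_nonneg (by positivity) (Finset.sum_nonneg fun i _ => (hP i).nonneg)
  have hT0 : 0 ≤ (T : H →L[ℂ] H) := by
    rw [hTcoe, sub_nonneg]
    have h1 : ∑ i, (P i : H →L[ℂ] H) ≤ N • 1 := by
      refine (Finset.sum_le_sum fun i _ => (hP i).le_one).trans ?_
      rw [Finset.sum_const, Finset.card_univ, hNdef, Nat.cast_smul_eq_nsmul]
    refine (smul_le_smul_of_nonneg_left h1 (by positivity)).trans ?_
    rw [smul_smul, one_div_mul_cancel hN.ne', one_smul]
  have hTn : ‖T‖ ≤ 1 := (CStarAlgebra.norm_le_one_iff_of_nonneg _ hT0).2 hT1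
  have hKr' : ∀ v, v ∈ (K : H →L[ℂ] H).range ↔ (T : H →L[ℂ] H) v = v := by
    intro v
    have h2 : (T : H →L[ℂ] H) v = v - (1 / N) • (∑ i, (P i : H →L[ℂ] H)) v := by
      rw [hTcoe]; rfl
    rw [hKr, h2, sub_eq_self, smul_eq_zero_iff_right (by positivity), sum_apply_eq_zero_iff _ hP]
    simp
  -- The shift by `2` keeps `δ k < 1` even at `k = 0`.
  set δ : ℕ → ℝ := fun k => 1 / ((k : ℝ) + 2) with hδdef
  have hδ0 : ∀ k, 0 < δ k := fun k => by positivity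
  have hδ1 : ∀ k, δ k < 1 := fun k => by
    simp only [hδdef]
    rw [div_lt_one (by positivity)]
    have : (0 : ℝ) ≤ k := Nat.cast_nonneg k
    linarith
  have hδa : Antitone δ := fun i j hij => by
    simp only [hδdef]
    gcongr
  have hδ : Tendsto δ atTop (𝓝 0) :=
    tendsto_const_nhds.div_atTop (tendsto_atTop_add_const_right _ _ tendsto_natCast_atTop_atTop)
  set R : ℕ → M.toStarSubalgebra := fun k =>
    ⟨cfc (resolventFun (δ k)) (T : H →L[ℂ] H), VonNeumannAlgebra.cfc_mem T.2 _⟩ with hR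
  have hlim : Tendsto (fun k => (τ (R k)).re) atTop (𝓝 (τ K).re) := by
    -- The Abel means decrease along `k`, so normality is applied to their complements.
    have h1 := hτ.tendsto_of_monotone (A := fun k => 1 - R k) (B := 1 - K) (fun k => ?_)
      (fun i j hij => ?_) fun v => ?_
    · simp only [map_sub, hτ.map_one, Complex.sub_re, Complex.one_re] at h1
      simpa using tendsto_const_nhds (x := (1 : ℝ)).sub h1
    · refine (IsSelfAdjoint.one _).sub (Subtype.ext ?_)
      exact (cfc_predicate (resolventFun (δ k)) (T : H →L[ℂ] H) : IsSelfAdjoint _)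
    · refine sub_le_sub_left (?_ : (R j : H →L[ℂ] H) ≤ R i) (1 : H →L[ℂ] H)
      exact cfc_resolventFun_mono hT0 hT1 (hδ0 j) (hδa hij) (hδ1 i).le
    · exact (tendsto_const_nhds (x := v)).sub
        (tendsto_cfc_resolventFun hT0 hT1 hδ0 (fun k => (hδ1 k).le) hδ hK hKr' v)
  have hle : ∀ k, τ (R k) ≤ 1 := fun k => by
    rw [← hτ.map_one]
    exact hτ.mono (cfc_resolventFun_le_one hT0 hT1 (hδ0 k) (hδ1 k).le)
  have hge : ∀ k, ((δ k : ℝ) : ℂ) ≤ τ (R k) := fun k => by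
    have h1 : τ (((δ k : ℝ) : ℂ) • 1) = (δ k : ℝ) := by rw [map_smul, hτ.map_one]; simp
    rw [← h1]
    exact hτ.mono (le_cfc_resolventFun hT0 hT1 (hδ0 k) (hδ1 k).le)
  refine eq_max_of_resolvent_relation hδ0 hδ hδ1 hN1 hlim
    (fun k => (Complex.le_def.1 (hle k)).1) (fun k => (Complex.le_def.1 (hge k)).1) fun k => ?_
  set x : ℂ := ((1 - δ k : ℝ) : ℂ) with hx
  have hx1 : ‖x‖ < 1 := by
    rw [hx, Complex.norm_real, Real.norm_eq_abs, abs_of_pos (by linarith [hδ1 k])]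
    linarith [hδ0 k]
  have hxR : (1 - x) * τ (Ring.inverse (1 - x • T)) = τ (R k) := by
    have e1 : (1 - x • T) * R k = ((δ k : ℝ) : ℂ) • 1 :=
      Subtype.ext (cfc_resolventFun_mul hT0 hT1 (hδ0 k) (hδ1 k).le).2
    have hu : IsUnit (1 - x • T) := isUnit_one_sub_of_norm_lt_one <| by
      rw [norm_smul]
      exact (mul_le_of_le_one_right (norm_nonneg _) hTn).trans_lt hx1
    have e2 : R k = ((δ k : ℝ) : ℂ) • Ring.inverse (1 - x • T) := by
      rw [← mul_one (Ring.inverse _), ← mul_smul_comm, ← e1, ← mul_assoc,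
        Ring.inverse_mul_cancel _ hu, one_mul]
    rw [e2, map_smul, smul_eq_mul]
    congr 1
    rw [hx]; push_cast; ring
  have hrel := AlternatingCentered.resolvent_relation hτ.toCLM hτ.map_one
    (fun i => Subtype.ext (hP i).isIdempotentElem) hfree (N := N) (by simp [hNdef])
    (by exact_mod_cast hN.ne') hT hTn _ (fun _ => rfl) hx1
  simp only [IsFaithfulNormalTracialState.toCLM_apply] at hrel
  rw [hxR] at hrel
  -- The trace of a positive element is real, so the complex relation descends to the reals.
  have hre : τ (R k) = ((τ (R k)).re : ℂ) :=
    Complex.ext rfl (by simpa using (Complex.le_def.1 (hle k)).2)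
  rw [hre, hx] at hrel
  have h3 : (((1 - δ k) * (τ (R k)).re * ((τ (R k)).re - 1 + N * p) : ℝ) : ℂ) =
      ((δ k * ((τ (R k)).re + N - 1) * (1 - (τ (R k)).re) : ℝ) : ℂ) := by
    push_cast at hrel ⊢
    rw [hrel]; ring
  exact_mod_cast h3

end KernelTrace

/-! ### Kernels of the spectral projections of a maximum -/

section SpectralMaximum

variable {H : Type u} [NormedAddCommGroup H] [InnerProductSpace ℂ H] [CompleteSpace H]

/-- The von Neumann algebra generated by the operator `X`. -/
noncomputable def generatedVonNeumannAlgebra (X : H →L[ℂ] H) : VonNeumannAlgebra H :=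
  VonNeumannAlgebra.commutant
    { toStarSubalgebra := StarSubalgebra.centralizer ℂ {X}
      centralizer_centralizer' := by simp }

/-- With the bicommutant bundled as a von Neumann algebra, `spectralProjection_mem` applies to it
and places the spectral projections of `X` in $W^*(X)$. -/
theorem mem_generatedVonNeumannAlgebra_iff {X Y : H →L[ℂ] H} :
    Y ∈ generatedVonNeumannAlgebra X ↔ Y ∈ generatedVonNeumann X := by
  have h : ((StarSubalgebra.centralizer ℂ {X} : StarSubalgebra ℂ (H →L[ℂ] H)) :
      Set (H →L[ℂ] H)) = Set.centralizer {X, star X} := by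
    rw [StarSubalgebra.coe_centralizer, Set.star_singleton, Set.singleton_union]
  rw [generatedVonNeumann, ← h, ← SetLike.mem_coe, generatedVonNeumannAlgebra,
    VonNeumannAlgebra.coe_commutant]
  rfl

theorem self_mem_generatedVonNeumannAlgebra (X : H →L[ℂ] H) :
    X ∈ generatedVonNeumannAlgebra X := by
  rw [mem_generatedVonNeumannAlgebra_iff]
  exact fun y hy => (hy X (by simp)).symm

theorem IsStarProjection.apply_eq_zero_iff {P : H →L[ℂ] H} (hP : IsStarProjection P) (v : H) :
    P v = 0 ↔ v ∈ P.rangeᗮ := by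
  have h2 : ContinuousLinearMap.adjoint P = P := hP.isSelfAdjoint
  rw [ContinuousLinearMap.orthogonal_range, h2]
  rfl

theorem spectralProjection_apply_eq_zero_iff {X : H →L[ℂ] H} (hX : IsSelfAdjoint X) (y : ℝ)
    (v : H) : spectralProjection X (Set.Ioi y) v = 0 ↔
      cfc (fun t : ℝ => max (t - y) 0) X v = 0 := by
  rw [(isStarProjection_spectralProjection X _).apply_eq_zero_iff, range_spectralProjection,
    spectralSubspace_Ioi X hX, Submodule.orthogonal_orthogonal]
  rfl

/-- The orthogonal complement of a closed sum is the intersection of the complements. Suprema of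
projections thus become conjunctions of kernel conditions. -/
theorem projectionSup_apply_eq_zero_iff {P Q : H →L[ℂ] H} (hP : IsStarProjection P)
    (hQ : IsStarProjection Q) (v : H) : projectionSup P Q v = 0 ↔ P v = 0 ∧ Q v = 0 := by
  have hs : IsStarProjection (projectionSup P Q) := isStarProjection_starProjection
  have hr : (projectionSup P Q).range = (P.range ⊔ Q.range).topologicalClosure :=
    Submodule.range_starProjection _
  rw [hs.apply_eq_zero_iff, hr, Submodule.orthogonal_closure, ← Submodule.inf_orthogonal,
    Submodule.mem_inf, hP.apply_eq_zero_iff, hQ.apply_eq_zero_iff]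

theorem spectralMax_apply_eq_zero_iff {M : VonNeumannAlgebra H}
    (U : ℕ → selfAdjoint M.toStarSubalgebra) (y : ℝ) (v : H) (n : ℕ) :
    spectralProjection (spectralMax U (n + 1) : H →L[ℂ] H) (Set.Ioi y) v = 0 ↔
      ∀ i : Fin (n + 1), spectralProjection (U i : H →L[ℂ] H) (Set.Ioi y) v = 0 := by
  induction n with
  | zero => simp [spectralMax]
  | succ n ih =>
    rw [Fin.forall_fin_succ', spectralMax, spectralProjection_spectralSup,
      projectionSup_apply_eq_zero_iff (isStarProjection_spectralProjection _ _)
        (isStarProjection_spectralProjection _ _), ih]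
    simp

/-- The hypothesis makes $E_X((r,\infty))$ the identity for `r < 0`. The negative part of `X - r`
vanishes on its range, hence vanishes, and so does the function `max (r - t) 0` at each spectral
point. -/
theorem nonneg_of_mem_spectrum {X : H →L[ℂ] H} (hX : IsSelfAdjoint X)
    (h : ∀ s < 0, ∀ v, spectralProjection X (Set.Ioi s) v = 0 → v = 0) {t : ℝ}
    (ht : t ∈ spectrum ℝ X) : 0 ≤ t := by
  refine le_of_forall_lt fun s hs => ?_
  obtain ⟨r, hsr, hr⟩ := exists_between hs
  refine hsr.trans_le ?_
  have htop : spectralSubspace X (Set.Ioi r) = ⊤ := by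
    rw [← Submodule.orthogonal_eq_bot_iff, eq_bot_iff, ← range_spectralProjection]
    intro v hv
    exact h r hr v (((isStarProjection_spectralProjection X _).apply_eq_zero_iff v).2 hv)
  have hker : spectralSubspace X (Set.Ioi r) ≤ (cfc (fun t : ℝ => max (r - t) 0) X).ker := by
    refine spectralSubspace_le X (ContinuousLinearMap.isClosed_ker _) fun K _ hKB v hv => ?_
    exact hv _ (by fun_prop) fun u hu => max_eq_right (sub_nonpos.2 (hKB hu).le)
  have hzero : cfc (fun t : ℝ => max (r - t) 0) X = 0 := by
    ext v
    exact hker (htop ▸ Submodule.mem_top)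
  have := norm_apply_le_norm_cfc (fun t : ℝ => max (r - t) 0) X ht
  rw [hzero, norm_zero, norm_le_zero_iff] at this
  exact sub_nonpos.1 ((le_max_left _ _).trans this.le)

/-- Without spectrum below `0`, membership in $E_X([0,y])$ only asks that $(X-y)_+$ kill `v`.
Conversely, a continuous `f` vanishing on `[0, y]` is, up to a uniformly small error on the
spectrum, a continuous multiple of $(t-y)_+$. -/
theorem mem_spectralSubspace_Icc_iff {X : H →L[ℂ] H} (hX : IsSelfAdjoint X)
    (hpos : ∀ t ∈ spectrum ℝ X, 0 ≤ t) {y : ℝ} (hy : 0 ≤ y) (v : H) :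
    v ∈ spectralSubspace X (Set.Icc 0 y) ↔ spectralProjection X (Set.Ioi y) v = 0 := by
  rw [spectralProjection_apply_eq_zero_iff hX]
  constructor
  · have hle : spectralSubspace X (Set.Icc 0 y) ≤ (cfc (fun t : ℝ => max (t - y) 0) X).ker := by
      refine spectralSubspace_le X (ContinuousLinearMap.isClosed_ker _) fun K _ hKB v hv => ?_
      exact hv _ (by fun_prop) fun u hu => max_eq_right (sub_nonpos.2 (hKB hu).2)
    exact fun hv => hle hv
  · intro hv
    refine closedSpectralSubspace_le X isClosed_Icc subset_rfl fun f hf hf0 => ?_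
    have hsmall : ∀ ε > 0, ‖cfc f X v‖ ≤ ε * ‖v‖ := by
      intro ε hε
      obtain ⟨d, hd, hfd⟩ : ∃ d > 0, ∀ t ∈ Set.Icc y (y + d), |f t| ≤ ε := by
        obtain ⟨η, hη, h⟩ := Metric.continuousAt_iff.1 (hf.continuousAt (x := y)) ε hε
        refine ⟨η / 2, by linarith, fun t ht => ?_⟩
        have h1 : dist t y < η := by
          rw [Real.dist_eq, abs_of_nonneg (by linarith [ht.1])]; linarith [ht.2]
        have h2 := h h1
        rw [hf0 y ⟨hy, le_rfl⟩, Real.dist_eq, sub_zero] at h2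
        exact h2.le
      -- Freezing `f` beyond `y + d` leaves a function small on the spectrum; the difference
      -- vanishes for `t ≤ y + d`, so it is divisible by $(t-y)_+$ with a continuous quotient.
      set q : ℝ → ℝ := fun t => (f t - f (min t (y + d))) / max (t - y) d with hq
      have hqc : Continuous q := by
        refine Continuous.div (by fun_prop) (by fun_prop) fun t => ?_
        exact (lt_max_of_lt_right hd).ne'
      have e1 : f = fun t => q t * max (t - y) 0 + f (min t (y + d)) := by
        funext t
        rcases le_total t (y + d) with h | h
        · simp [hq, min_eq_left h]
        · have h1 : max (t - y) d = t - y := max_eq_left (by linarith)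
          have h2 : max (t - y) 0 = t - y := max_eq_left (by linarith)
          have h3 : t - y ≠ 0 := by linarith
          simp only [hq, h1, h2, min_eq_right h]
          field_simp
          ring
      have e2 : cfc f X v = cfc (fun t => f (min t (y + d))) X v := by
        conv_lhs => rw [e1]
        rw [cfc_add X (fun t => q t * max (t - y) 0) (fun t => f (min t (y + d))) (by fun_prop) (by fun_prop),
          cfc_mul q (fun t => max (t - y) 0) X (by fun_prop) (by fun_prop)]
        have : cfc q X (cfc (fun t : ℝ => max (t - y) 0) X v) = 0 := by rw [hv, map_zero]
        calc _ = cfc q X (cfc (fun t : ℝ => max (t - y) 0) X v) +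
              cfc (fun t => f (min t (y + d))) X v := rfl
          _ = _ := by rw [this, zero_add]
      rw [e2]
      refine (ContinuousLinearMap.le_opNorm _ _).trans ?_
      gcongr
      refine norm_cfc_le hε.le fun t ht => ?_
      have ht0 := hpos t ht
      rw [Real.norm_eq_abs]
      rcases le_total t y with h | h
      · rw [min_eq_left (by linarith), hf0 t ⟨ht0, h⟩, abs_zero]
        exact hε.le
      · exact hfd _ ⟨le_min h (by linarith), min_le_right _ _⟩
    have hlim : Tendsto (fun ε : ℝ => ε * ‖v‖) (𝓝[>] 0) (𝓝 (0 * ‖v‖)) :=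
      (tendsto_nhdsWithin_of_tendsto_nhds tendsto_id).mul_const _
    rw [zero_mul] at hlim
    exact norm_le_zero_iff.1 (ge_of_tendsto hlim (by
      filter_upwards [self_mem_nhdsWithin] with ε hε using hsmall ε hε))

end SpectralMaximum

/-! ### The law of the maximum of free uniform variables -/

section FreeMaximum

variable {H : Type u} [NormedAddCommGroup H] [InnerProductSpace ℂ H] [CompleteSpace H]
  {M : VonNeumannAlgebra H} {τ : M.toStarSubalgebra →ₗ[ℂ] ℂ}

theorem IsFaithfulNormalTracialState.map_spectralE (hτ : IsFaithfulNormalTracialState τ)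
    (X : selfAdjoint M.toStarSubalgebra) (B : Set ℝ) :
    τ (spectralE X B) = (spectralDistribution τ X B : ℂ) := by
  have h := hτ.map_nonneg (a := spectralE X B) (isStarProjection_spectralProjection _ B).nonneg
  exact Complex.ext rfl (by simpa using (Complex.le_def.1 h).2.symm)

/-- The complementary projection has trace zero, so faithfulness kills it. -/
theorem IsFaithfulNormalTracialState.spectralE_eq_one (hτ : IsFaithfulNormalTracialState τ)
    (X : selfAdjoint M.toStarSubalgebra) (B : Set ℝ) (h : spectralDistribution τ X B = 1) :
    spectralE X B = 1 := by
  have hs : IsStarProjection (1 - spectralProjection (X : H →L[ℂ] H) B) :=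
    (isStarProjection_spectralProjection _ B).one_sub
  have h1 : star (1 - spectralE X B) * (1 - spectralE X B) = 1 - spectralE X B := by
    refine Subtype.ext ?_
    calc _ = star (1 - spectralProjection (X : H →L[ℂ] H) B) *
          (1 - spectralProjection (X : H →L[ℂ] H) B) := rfl
      _ = _ := by rw [hs.isSelfAdjoint.star_eq, hs.isIdempotentElem.eq]; rfl
  have h2 := hτ.faithful (1 - spectralE X B) (by
    rw [h1, map_sub, hτ.map_one, hτ.map_spectralE, h]; simp)
  exact (sub_eq_zero.1 h2).symm

/-- Spectral projections of free elements, with a common trace, form a free family. -/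
theorem FreelyIndependent.alternatingCentered (hτ : IsFaithfulNormalTracialState τ)
    {U : ℕ → selfAdjoint M.toStarSubalgebra} (hfree : FreelyIndependent τ U) (B : Set ℝ) {p : ℝ}
    (hp : ∀ i, spectralDistribution τ (U i) B = p) (n : ℕ) :
    AlternatingCentered hτ.toCLM (fun i : Fin n => spectralE (U i) B) (p : ℂ) := by
  intro l hl hc
  have h1 := hfree (l.map fun i : Fin n => ((i : ℕ), spectralE (U i) B - algebraMap ℂ _ (p : ℂ)))
    (by simpa using hl) ?_ ?_
  · rw [List.map_map] at h1
    exact h1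
  · rw [List.isChain_map]
    exact hc.imp fun i j hij => Fin.val_ne_of_ne hij
  · intro q hq
    obtain ⟨i, _, rfl⟩ := List.mem_map.1 hq
    constructor
    · rw [← mem_generatedVonNeumannAlgebra_iff]
      have h2 := spectralProjection_mem (self_mem_generatedVonNeumannAlgebra (U i : H →L[ℂ] H)) B
      exact sub_mem h2 (algebraMap_mem
        (generatedVonNeumannAlgebra (U i : H →L[ℂ] H)).toStarSubalgebra (p : ℂ))
    · rw [map_sub, hτ.map_spectralE, hp, Algebra.algebraMap_eq_smul_one, map_smul, hτ.map_one]
      simp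

theorem uniform01_real_Ioi {y : ℝ} (h0 : 0 ≤ y) (h1 : y ≤ 1) :
    uniform01.real (Set.Ioi y) = 1 - y := by
  rw [uniform01, measureReal_restrict_apply measurableSet_Ioi,
    show Set.Ioi y ∩ Set.Ioo 0 1 = Set.Ioo y 1 by ext t; simp; grind]
  rw [Real.volume_real_Ioo_of_le h1]

theorem uniform01_real_Ioi_of_neg {y : ℝ} (h0 : y < 0) : uniform01.real (Set.Ioi y) = 1 := by
  rw [uniform01, measureReal_restrict_apply measurableSet_Ioi,
    show Set.Ioi y ∩ Set.Ioo 0 1 = Set.Ioo 0 1 by ext t; simp; grind]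
  simp

/-- The distribution function of the maximum of `n` free uniform variables. -/
theorem spectralDistribution_spectralMax (hτ : IsFaithfulNormalTracialState τ)
    {U : ℕ → selfAdjoint M.toStarSubalgebra} (hfree : FreelyIndependent τ U)
    (hU : ∀ i, HasSpectralLaw τ (U i) uniform01) {n : ℕ} (hn : n ≠ 0) {y : ℝ} (h0 : 0 ≤ y)
    (h1 : y ≤ 1) :
    spectralDistribution τ (spectralMax U n) (Set.Icc 0 y) = max 0 (1 - n * (1 - y)) := by
  obtain ⟨n, rfl⟩ := Nat.exists_eq_succ_of_ne_zero hn
  have hsa : IsSelfAdjoint (spectralMax U (n + 1) : H →L[ℂ] H) :=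
    congr_arg Subtype.val (spectralMax U (n + 1)).2
  -- One variable suffices: for `s < 0` the projection of `U 0` is the identity, and a vector killed
  -- by the projection of the maximum is killed by it.
  have hpos : ∀ t ∈ spectrum ℝ (spectralMax U (n + 1) : H →L[ℂ] H), 0 ≤ t := by
    refine fun t => nonneg_of_mem_spectrum hsa fun s hs v hv => ?_
    rw [spectralMax_apply_eq_zero_iff] at hv
    have h2 := hτ.spectralE_eq_one (U 0) (Set.Ioi s)
      ((hU 0 _ measurableSet_Ioi).trans (uniform01_real_Ioi_of_neg hs))
    have h3 : spectralProjection (U 0 : H →L[ℂ] H) (Set.Ioi s) = 1 := congr_arg Subtype.val h2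
    have h4 : spectralProjection (U 0 : H →L[ℂ] H) (Set.Ioi s) v = 0 := hv 0
    rw [h3] at h4
    exact h4
  have hp : ∀ i, spectralDistribution τ (U i) (Set.Ioi y) = 1 - y := fun i =>
    (hU i _ measurableSet_Ioi).trans (uniform01_real_Ioi h0 h1)
  have h2 := hτ.trace_iInf_ker (P := fun i : Fin (n + 1) => spectralE (U i) (Set.Ioi y))
    (K := spectralE (spectralMax U (n + 1)) (Set.Icc 0 y))
    (fun i => isStarProjection_spectralProjection _ _)
    (hfree.alternatingCentered hτ _ hp _) (isStarProjection_spectralProjection _ _) fun v => by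
      rw [show (spectralE (spectralMax U (n + 1)) (Set.Icc 0 y) : H →L[ℂ] H) =
        spectralProjection (spectralMax U (n + 1) : H →L[ℂ] H) (Set.Icc 0 y) from rfl,
        range_spectralProjection, mem_spectralSubspace_Icc_iff hsa hpos h0,
        spectralMax_apply_eq_zero_iff]
      rfl
  rw [Fintype.card_fin] at h2
  exact h2

end FreeMaximum

/-! ### Limits of powers and the three extreme value types -/

section Limits

theorem tendsto_max_one_sub {c : ℝ} (h0 : 0 ≤ c) :
    Tendsto (fun n : ℕ => max 0 (1 - (n : ℝ) * (1 - c ^ (1 / (n : ℝ))))) atTop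
      (𝓝 (lambdaMax c)) := by
  rcases h0.eq_or_lt with rfl | hc
  · rw [lambdaMax, if_pos rfl]
    refine tendsto_const_nhds.congr' ?_
    filter_upwards [eventually_ge_atTop 1] with n hn
    have hn' : (1 : ℝ) ≤ n := by exact_mod_cast hn
    -- For `c = 0` and `n ≥ 1` the power is `0`, and `1 - n ≤ 0` is cut off at `0`.
    rw [Real.zero_rpow (by positivity), max_eq_left (by linarith)]
  · rw [lambdaMax, if_neg hc.ne']
    refine tendsto_const_nhds.max ?_
    have h1 : Tendsto (fun n : ℕ => 1 / (n : ℝ)) atTop (𝓝[>] 0) := by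
      refine tendsto_nhdsWithin_iff.2 ⟨tendsto_one_div_atTop_nhds_zero_nat, ?_⟩
      filter_upwards [eventually_ge_atTop 1] with n hn
      have hn' : (0 : ℝ) < n := by exact_mod_cast hn
      exact one_div_pos.2 hn'
    refine (((tendsto_rpow_sub_one_log hc).comp h1).const_add 1).congr fun n => ?_
    simp only [Function.comp_apply, one_div, inv_inv]
    ring

theorem IsDistributionFunction.nonneg {F : ℝ → ℝ} (hF : IsDistributionFunction F) (x : ℝ) :
    0 ≤ F x := hF.mono.le_of_tendsto hF.tendsto_atBot x

theorem IsDistributionFunction.le_one {F : ℝ → ℝ} (hF : IsDistributionFunction F) (x : ℝ) :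
    F x ≤ 1 := hF.mono.ge_of_tendsto hF.tendsto_atTop x

/-- Each classical law has the form `exp (-t)` where it is not constant, with `t` equal to `exp
(-x)`, `x ^ (-α)` or `(-x) ^ α`; this turns it into its free counterpart. -/
theorem lambdaMax_exp (t : ℝ) : lambdaMax (Real.exp (-t)) = max 0 (1 - t) := by
  rw [lambdaMax, if_neg (Real.exp_pos _).ne', Real.log_exp, sub_eq_add_neg]

theorem gumbel_mem_Icc (x : ℝ) : gumbel x ∈ Set.Icc (0 : ℝ) 1 :=
  ⟨(Real.exp_pos _).le, Real.exp_le_one_iff.2 (neg_nonpos.2 (Real.exp_pos _).le)⟩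

theorem frechet_mem_Icc (α x : ℝ) : frechet α x ∈ Set.Icc (0 : ℝ) 1 := by
  rw [frechet]
  split_ifs with h
  · exact ⟨(Real.exp_pos _).le, Real.exp_le_one_iff.2 (neg_nonpos.2 (Real.rpow_nonneg h.le _))⟩
  · simp

theorem weibull_mem_Icc (α x : ℝ) : weibull α x ∈ Set.Icc (0 : ℝ) 1 := by
  rw [weibull]
  split_ifs with h
  · exact ⟨(Real.exp_pos _).le,
      Real.exp_le_one_iff.2 (neg_nonpos.2 (Real.rpow_nonneg (neg_nonneg.2 h) _))⟩
  · simp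

theorem lambdaMax_gumbel (x : ℝ) : lambdaMax (gumbel x) = freeGumbel x := lambdaMax_exp _

theorem lambdaMax_frechet (α x : ℝ) : lambdaMax (frechet α x) = freeFrechet α x := by
  rw [frechet, freeFrechet]
  split_ifs with h
  · exact lambdaMax_exp _
  · simp [lambdaMax]

theorem lambdaMax_weibull {α : ℝ} (hα : 0 < α) (x : ℝ) :
    lambdaMax (weibull α x) = freeWeibull α x := by
  rw [weibull, freeWeibull]
  -- At `x = -1` the exponent `(-x) ^ α` crosses `1`, which is where the maximum with `0` changes
  -- branch.
  rcases lt_or_ge x (-1) with h | h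
  · rw [if_pos (by linarith), if_pos h, lambdaMax_exp, max_eq_left]
    have := Real.one_le_rpow (show 1 ≤ -x by linarith) hα.le
    linarith
  · rw [if_neg h.not_gt]
    split_ifs with h0
    · rw [lambdaMax_exp, abs_of_nonpos h0, max_eq_right]
      have := Real.rpow_le_one (show 0 ≤ -x by linarith) (by linarith) hα.le
      linarith
    · simp [lambdaMax]

end Limits

/-! ### The limit theorem -/

theorem proposition5p1 {H : Type u} [NormedAddCommGroup H] [InnerProductSpace ℂ H]
    [CompleteSpace H] (M : VonNeumannAlgebra H) (τ : M.toStarSubalgebra →ₗ[ℂ] ℂ)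
    (hτ : IsFaithfulNormalTracialState τ) (U : ℕ → selfAdjoint M.toStarSubalgebra)
    (hfree : FreelyIndependent τ U) (hU : ∀ i, HasSpectralLaw τ (U i) uniform01) :
    (∀ F : ℝ → ℝ, IsDistributionFunction F →
      ConvergesWeakly
        (fun n x => spectralDistribution τ (spectralMax U n) (Set.Icc 0 (F x ^ (1 / (n : ℝ)))))
        (fun x => lambdaMax (F x))) ∧
    ConvergesWeakly
      (fun n x => spectralDistribution τ (spectralMax U n) (Set.Icc 0 (gumbel x ^ (1 / (n : ℝ)))))
      freeGumbel ∧
    (∀ α : ℝ, 0 < α →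
      ConvergesWeakly
        (fun n x =>
          spectralDistribution τ (spectralMax U n) (Set.Icc 0 (frechet α x ^ (1 / (n : ℝ)))))
        (freeFrechet α)) ∧
    ∀ α : ℝ, 0 < α →
      ConvergesWeakly
        (fun n x =>
          spectralDistribution τ (spectralMax U n) (Set.Icc 0 (weibull α x ^ (1 / (n : ℝ)))))
        (freeWeibull α) := by

  -- The point `x` enters only through the value `c` of the distribution function there, so one
  -- limit at fixed `c` serves all four claims.
  have key : ∀ c ∈ Set.Icc (0 : ℝ) 1, Tendsto
      (fun n : ℕ => spectralDistribution τ (spectralMax U n) (Set.Icc 0 (c ^ (1 / (n : ℝ)))))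
      atTop (𝓝 (lambdaMax c)) := by
    intro c hc
    refine (tendsto_max_one_sub hc.1).congr' ?_
    filter_upwards [eventually_ne_atTop 0] with n hn
    exact (spectralDistribution_spectralMax hτ hfree hU hn (Real.rpow_nonneg hc.1 _)
      (Real.rpow_le_one hc.1 hc.2 (by positivity))).symm
  refine ⟨fun F hF x _ => key _ ⟨hF.nonneg x, hF.le_one x⟩, fun x _ => ?_,
    fun α _ x _ => ?_, fun α hα x _ => ?_⟩
  · rw [← lambdaMax_gumbel]; exact key _ (gumbel_mem_Icc x)
  · rw [← lambdaMax_frechet]; exact key _ (frechet_mem_Icc α x)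
  · rw [← lambdaMax_weibull hα]; exact key _ (weibull_mem_Icc α x)
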